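/- Conventions. Rings are associative with unit. $R$ is Noetherian on both sides. Modules are left modules; right $R$-modules are modules over $R^{\mathrm{op}}$. A ring homomorphism $\varphi\colon R\to A$ is finite if $A$ is finitely generated both as a left and as a right $R$-module. For a finitely generated module $X$ over a ring $S$ that is Noetherian on both sides, and $k\ge 0$: * $\Omega^k_S(X)$ denotes a $k$-th syzygy: there is an exact sequence $0\to \Omega^k_S(X)\to P_{k-1}\to\cdots\to P_0\to X\to 0$ with all $P_i$ finitely generated projective ($\Omega^0_S(X)\cong X$). * A transpose $\mathrm{Tr}_S(X)$ is a right $S$-module isomorphic to $\mathrm{Coker}(\mathrm{Hom}_S(P_0,S)\to\mathrm{Hom}_S(P_1,S))$, where $P_1\to P_0\to X\to 0$ is exact with $P_0,P_1$ finitely generated projective. * A module is Gorenstein projective if it is isomorphic to the image of a differential of an acyclic complex $\mathbf P$ of projective modules such that $\mathrm{Hom}_S(\mathbf P,Q)$ is acyclic for every projective $Q$. $\mathrm{Gpd}_S(X)<\infty$ means that $X$ has a finite resolution by Gorenstein projective modules. * A Gorenstein transpose $\mathrm{Tr}^{G}_S(X)$ is a right $S$-module isomorphic to $\mathrm{Coker}(\mathrm{Hom}_S(G_0,S)\to\mathrm{Hom}_S(G_1,S))$,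 where $G_1\to G_0\to X\to 0$ is exact with $G_0,G_1$ finitely generated Gorenstein projective. $\mathrm{Hom}_R(A,R)$ and $\mathrm{Ext}^n_R(A,R)$ are left $A$-modules through right multiplication on $A$ and right $R$-modules through right multiplication on $R$; for commutative $R$ left and right $R$-modules are identified. **Theorem.** Let $\varphi\colon R\to A$ be a finite ring homomorphism, where $R$ is Noetherian on both sides. Assume that $\mathrm{Gpd}_R(A)<\infty$ and that there is $n\ge 0$ with $\mathrm{Ext}^i_R(A,R)=0$ for all $i\ne n$. Let $M$ be a finitely generated $A$-module, let $P_1\xrightarrow{f}P_0\to M\to 0$ be an exact sequence of $A$-modules with $P_0,P_1$ finitely generated projective, and put $\mathrm{Tr}_A(M)=\mathrm{Coker}(\mathrm{Hom}_A(f,A))$ and $\Omega^2_A(M)=\mathrm{Ker} f$. 1. If $n=0$, then there are a Gorenstein transpose $\mathrm{Tr}^G_R(M)$ of $M$ over $R$ and an isomorphism of right $R$-modules $$\mathrm{Tr}^G_R(M)\cong \mathrm{Tr}_A(M)\otimes_A\mathrm{Hom}_R(A,R).$$ 2. If $n=1$ and $R$ is commutative, then for every syzygy $\Omega^1_R(M)$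 there are a Gorenstein transpose $\mathrm{Tr}^G_R(\Omega^1_R(M))$, a finitely generated projective $R$-module $Q$ and a short exact sequence of $R$-modules $$0\to Q\to \mathrm{Tr}^G_R(\Omega^1_R(M))\to \mathrm{Tr}_A(M)\otimes_A\mathrm{Ext}^1_R(A,R)\to 0.$$ 3. If $n\ge 2$ and $R$ is commutative, then for every syzygy $\Omega^n_R(M)$, every syzygy $\Omega^{n-2}_R(\Omega^2_A(M))$ and every transpose $\mathrm{Tr}_R(\Omega^{n-2}_R(\Omega^2_A(M)))$ of the latter, there are a Gorenstein transpose $\mathrm{Tr}^G_R(\Omega^n_R(M))$ and a short exact sequence of $R$-modules $$0\to \mathrm{Tr}_R(\Omega^{n-2}_R(\Omega^2_A(M)))\to \mathrm{Tr}^G_R(\Omega^n_R(M))\to \mathrm{Tr}_A(M)\otimes_A\mathrm{Ext}^n_R(A,R)\to 0,$$ and $\mathrm{pd}_R\,\mathrm{Tr}_R(\Omega^{n-2}_R(\Omega^2_A(M)))\le n-1$. -/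

import Mathlib

open CategoryTheory
open scoped TensorProduct

universe u

noncomputable section

namespace GorTranspose

/-! ## Presentations, syzygies and transposes

Left modules over a ring `R` are objects of `ModuleCat R`; right modules are objects of
`ModuleCat Rᵐᵒᵖ`. -/

section OneRing

variable {R : Type u} [Ring R]

/-- `P₁ ⟶ P₀ ⟶ M ⟶ 0` is exact, with `P₀` and `P₁` finitely generated projective. -/
structure IsProjPresentation {P₁ P₀ M : ModuleCat.{u} R} (f : P₁ ⟶ P₀) (p : P₀ ⟶ M) : Prop where
  finite₁ : Module.Finite R P₁
  projective₁ : Module.Projective R P₁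
  finite₀ : Module.Finite R P₀
  projective₀ : Module.Projective R P₀
  exact : Function.Exact f p
  surjective : Function.Surjective p

/-- `IsSyzygy n M N`: the module `N` is an `n`-th syzygy of `M`, that is, there is an exact sequence
`0 ⟶ N ⟶ P_{n-1} ⟶ ⋯ ⟶ P_0 ⟶ M ⟶ 0` with all `P_i` finitely generated projective (for `n = 0`
this says that `N` is isomorphic to `M`). The sequence is spliced from short exact sequences. -/
inductive IsSyzygy : ℕ → ModuleCat.{u} R → ModuleCat.{u} R → Prop
  | zero (M N : ModuleCat.{u} R) (e : M ≅ N) : IsSyzygy 0 M N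
  | succ (n : ℕ) (M M' P N : ModuleCat.{u} R) (i : M' ⟶ P) (p : P ⟶ M)
      (finite : Module.Finite R P) (projective : Module.Projective R P)
      (injective : Function.Injective i) (exact : Function.Exact i p)
      (surjective : Function.Surjective p) (h : IsSyzygy n M' N) : IsSyzygy (n + 1) M N

/-- `Hom_R(f, R) : Hom_R(Y, R) ⟶ Hom_R(X, R)`, as a map of right `R`-modules. -/
def dualMap {X Y : ModuleCat.{u} R} (f : X ⟶ Y) : (Y →ₗ[R] R) →ₗ[Rᵐᵒᵖ] (X →ₗ[R] R) :=
  LinearMap.lcomp Rᵐᵒᵖ R f.hom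

/-- The right `R`-module `Coker (Hom_R(f, R))`. -/
def dualCoker {X Y : ModuleCat.{u} R} (f : X ⟶ Y) : ModuleCat.{u} Rᵐᵒᵖ :=
  ModuleCat.of Rᵐᵒᵖ ((X →ₗ[R] R) ⧸ LinearMap.range (dualMap f))

/-- The right `R`-module `T` is (isomorphic to) a transpose of `M`. -/
def IsTranspose (M : ModuleCat.{u} R) (T : ModuleCat.{u} Rᵐᵒᵖ) : Prop :=
  ∃ (P₁ P₀ : ModuleCat.{u} R) (f : P₁ ⟶ P₀) (p : P₀ ⟶ M),
    IsProjPresentation f p ∧ Nonempty (T ≅ dualCoker f)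

/-! ## Gorenstein projective modules -/

/-- An acyclic complex `⋯ ⟶ P (i + 1) ⟶ P i ⟶ ⋯` (`i ∈ ℤ`) of projective modules, with
differentials `d i : P (i + 1) ⟶ P i`, such that `Hom_R(P, Q)` is acyclic for every projective
module `Q`. -/
structure IsTotallyAcyclic (P : ℤ → ModuleCat.{u} R) (d : ∀ i, P (i + 1) ⟶ P i) : Prop where
  projective : ∀ i, Module.Projective R (P i)
  acyclic : ∀ i, Function.Exact (d (i + 1)) (d i)
  hom_acyclic : ∀ Q : ModuleCat.{u} R, Module.Projective R Q → ∀ i,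
    Function.Exact (fun h : P i ⟶ Q => d i ≫ h) (fun g : P (i + 1) ⟶ Q => d (i + 1) ≫ g)

/-- `M` is Gorenstein projective: it is the image of a differential of a totally acyclic complex. -/
def IsGorensteinProjective (M : ModuleCat.{u} R) : Prop :=
  ∃ (P : ℤ → ModuleCat.{u} R) (d : ∀ i, P (i + 1) ⟶ P i),
    IsTotallyAcyclic P d ∧ Nonempty (M ≃ₗ[R] LinearMap.range (d 0).hom)

/-- `GpdLE n M`: the Gorenstein projective dimension of `M` is at most `n`, that is, there is an
exact sequence `0 ⟶ G_n ⟶ ⋯ ⟶ G_0 ⟶ M ⟶ 0` with all `G_i` Gorenstein projective. -/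
inductive GpdLE : ℕ → ModuleCat.{u} R → Prop
  | zero (M : ModuleCat.{u} R) (h : IsGorensteinProjective M) : GpdLE 0 M
  | succ (n : ℕ) (M K G : ModuleCat.{u} R) (i : K ⟶ G) (p : G ⟶ M)
      (gproj : IsGorensteinProjective G)
      (injective : Function.Injective i) (exact : Function.Exact i p)
      (surjective : Function.Surjective p) (h : GpdLE n K) : GpdLE (n + 1) M

/-- `G₁ ⟶ G₀ ⟶ M ⟶ 0` is exact, with `G₀` and `G₁` finitely generated Gorenstein projective. -/
structure IsGProjPresentation {G₁ G₀ M : ModuleCat.{u} R} (g : G₁ ⟶ G₀) (p : G₀ ⟶ M) : Prop where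
  finite₁ : Module.Finite R G₁
  gproj₁ : IsGorensteinProjective G₁
  finite₀ : Module.Finite R G₀
  gproj₀ : IsGorensteinProjective G₀
  exact : Function.Exact g p
  surjective : Function.Surjective p

/-- The right `R`-module `T` is (isomorphic to) a Gorenstein transpose of `M`. -/
def IsGorensteinTranspose (M : ModuleCat.{u} R) (T : ModuleCat.{u} Rᵐᵒᵖ) : Prop :=
  ∃ (G₁ G₀ : ModuleCat.{u} R) (g : G₁ ⟶ G₀) (p : G₀ ⟶ M),
    IsGProjPresentation g p ∧ Nonempty (T ≅ dualCoker g)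

end OneRing

/-! ## Tensor products over a noncommutative ring -/

/-- For a right `A`-module `X` and a left `A`-module `Y` with a commuting right `S`-action, the right
`S`-module `X ⊗_A Y`: the quotient of the tensor product of abelian groups by the relations
`xa ⊗ y = x ⊗ ay`. The factors are written in the order `Y ⊗ X`, since Mathlib lets scalars act
on the left factor. The span of the relations as a submodule is the same as their span as a
subgroup, because the two actions on `Y` commute. -/
def tensor (A S : Type u) [Ring A] [Ring S]
    (X : Type u) [AddCommGroup X] [Module Aᵐᵒᵖ X]
    (Y : Type u) [AddCommGroup Y] [Module A Y] [Module Sᵐᵒᵖ Y] [SMulCommClass A Sᵐᵒᵖ Y] :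
    ModuleCat.{u} Sᵐᵒᵖ :=
  ModuleCat.of Sᵐᵒᵖ ((Y ⊗[ℤ] X) ⧸ Submodule.span Sᵐᵒᵖ
    {z : Y ⊗[ℤ] X | ∃ (x : X) (a : A) (y : Y), z = y ⊗ₜ[ℤ] (MulOpposite.op a • x) - (a • y) ⊗ₜ[ℤ] x})

/-! ## The bimodules `Hom_R(A, R)` and `Ext^n_R(A, R)` -/

section Change

variable {R A : Type u} [Ring R] [Ring A] (φ : R →+* A)

/-- `A` as a left `R`-module via `φ`. -/
abbrev leftRestrict : ModuleCat.{u} R :=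
  (ModuleCat.restrictScalars φ).obj (ModuleCat.of A A)

/-- `A` as a right `R`-module via `φ`. -/
abbrev rightRestrict : ModuleCat.{u} Rᵐᵒᵖ :=
  (ModuleCat.restrictScalars (RingHom.op φ)).obj (ModuleCat.of Aᵐᵒᵖ Aᵐᵒᵖ)

/-- The ring homomorphism `φ` is finite: `A` is finitely generated as a left and as a right
`R`-module. -/
def IsFiniteHom : Prop :=
  Module.Finite R (leftRestrict φ) ∧ Module.Finite Rᵐᵒᵖ (rightRestrict φ)

/-- Right multiplication `x ↦ x * a` on `A`, as a map of left `R`-modules. -/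
def rightMul (a : A) : leftRestrict φ ⟶ leftRestrict φ :=
  (ModuleCat.restrictScalars φ).map (ModuleCat.ofHom (LinearMap.toSpanSingleton A A a))

/-- Right multiplication `x ↦ x * r` on `R`, as a map of left `R`-modules. -/
def rightMulSelf (r : R) : ModuleCat.of R R ⟶ ModuleCat.of R R :=
  ModuleCat.ofHom (LinearMap.toSpanSingleton R R r)

theorem rightMul_apply (a x : A) : (rightMul φ a).hom x = (x * a : A) := rfl

theorem rightMul_one : rightMul φ 1 = 𝟙 _ := by
  ext x; exact mul_one (show A from x)

theorem rightMul_mul (a b : A) : rightMul φ (a * b) = rightMul φ a ≫ rightMul φ b := by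
  ext x; exact (mul_assoc (show A from x) a b).symm

theorem rightMul_add (a b : A) : rightMul φ (a + b) = rightMul φ a + rightMul φ b := by
  ext x; exact mul_add (show A from x) a b

theorem rightMul_zero : rightMul φ 0 = 0 := by
  ext x; exact mul_zero (show A from x)

theorem rightMulSelf_one : rightMulSelf (1 : R) = 𝟙 _ := by
  ext; simp [rightMulSelf]

theorem rightMulSelf_mul (r s : R) : rightMulSelf (r * s) = rightMulSelf r ≫ rightMulSelf s := by
  ext; simp [rightMulSelf]

theorem rightMulSelf_add (r s : R) : rightMulSelf (r + s) = rightMulSelf r + rightMulSelf s := by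
  ext; simp [rightMulSelf]

theorem rightMulSelf_zero : rightMulSelf (0 : R) = 0 := by
  ext; simp [rightMulSelf]

/-- `Hom_R(A, R)`, a right `R`-module by `(f r)(x) = f(x) r`. -/
def HomAR : Type u := leftRestrict φ →ₗ[R] R

instance : AddCommGroup (HomAR φ) := inferInstanceAs (AddCommGroup (leftRestrict φ →ₗ[R] R))

instance : Module Rᵐᵒᵖ (HomAR φ) := inferInstanceAs (Module Rᵐᵒᵖ (leftRestrict φ →ₗ[R] R))

/-- `Hom_R(A, R)` is a left `A`-module by `(a f)(x) = f(x a)`. -/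
instance : Module A (HomAR φ) where
  smul a f := LinearMap.comp (show leftRestrict φ →ₗ[R] R from f) (rightMul φ a).hom
  one_smul f := by
    change LinearMap.comp _ (rightMul φ 1).hom = _
    rw [rightMul_one]; rfl
  mul_smul a b f := by
    change LinearMap.comp _ (rightMul φ (a * b)).hom = _
    rw [rightMul_mul]; rfl
  smul_zero a := LinearMap.zero_comp _
  smul_add a f g := LinearMap.add_comp _ _ _
  add_smul a b f := by
    change LinearMap.comp _ (rightMul φ (a + b)).hom = _
    rw [rightMul_add]; exact LinearMap.comp_add _ _ _
  zero_smul f := by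
    change LinearMap.comp _ (rightMul φ 0).hom = _
    rw [rightMul_zero]; exact LinearMap.comp_zero _

instance : SMulCommClass A Rᵐᵒᵖ (HomAR φ) where
  smul_comm _ _ _ := rfl

/-- `Ext^n_R(A, R)`, for the left `R`-modules `A` and `R`. -/
def ExtAR (n : ℕ) : Type u := Abelian.Ext.{u} (leftRestrict φ) (ModuleCat.of R R) n

instance (n : ℕ) : AddCommGroup (ExtAR φ n) :=
  inferInstanceAs (AddCommGroup (Abelian.Ext.{u} (leftRestrict φ) (ModuleCat.of R R) n))

/-- `Ext^n_R(A, R)` is a left `A`-module: `a` acts by functoriality in the first argument, through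
right multiplication by `a` on `A`. -/
instance (n : ℕ) : Module A (ExtAR φ n) where
  smul a e := (Abelian.Ext.mk₀ (rightMul φ a)).comp
    (show Abelian.Ext.{u} (leftRestrict φ) (ModuleCat.of R R) n from e) (zero_add n)
  one_smul e := by
    change (Abelian.Ext.mk₀ (rightMul φ 1)).comp _ _ = _
    rw [rightMul_one]; exact Abelian.Ext.mk₀_id_comp _
  mul_smul a b e := by
    change (Abelian.Ext.mk₀ (rightMul φ (a * b))).comp _ _ = _
    rw [rightMul_mul]; exact (Abelian.Ext.mk₀_comp_mk₀_assoc _ _ _).symm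
  smul_zero a := Abelian.Ext.comp_zero _ _ _ _ _
  smul_add a e e' := Abelian.Ext.comp_add _ _ _ _
  add_smul a b e := by
    change (Abelian.Ext.mk₀ (rightMul φ (a + b))).comp _ _ = _
    rw [rightMul_add, Abelian.Ext.mk₀_add]; exact Abelian.Ext.add_comp _ _ _ _
  zero_smul e := by
    change (Abelian.Ext.mk₀ (rightMul φ 0)).comp
      (show Abelian.Ext.{u} (leftRestrict φ) (ModuleCat.of R R) n from e) _ = _
    rw [rightMul_zero, Abelian.Ext.mk₀_zero]
    exact Abelian.Ext.zero_comp (X := leftRestrict φ) (Y := leftRestrict φ) (n := 0)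
      (show Abelian.Ext.{u} (leftRestrict φ) (ModuleCat.of R R) n from e) n (zero_add n)

/-- `Ext^n_R(A, R)` is a right `R`-module: `r` acts by functoriality in the second argument, through
right multiplication by `r` on `R`. For commutative `R` this is its usual `R`-module structure. -/
instance (n : ℕ) : Module Rᵐᵒᵖ (ExtAR φ n) where
  smul r e := (show Abelian.Ext.{u} (leftRestrict φ) (ModuleCat.of R R) n from e).comp
    (Abelian.Ext.mk₀ (rightMulSelf r.unop)) (add_zero n)
  one_smul e := by
    change Abelian.Ext.comp (show Abelian.Ext.{u} (leftRestrict φ) (ModuleCat.of R R) n from e)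
      (Abelian.Ext.mk₀ (rightMulSelf 1)) _ = _
    rw [rightMulSelf_one]; exact Abelian.Ext.comp_mk₀_id _
  mul_smul r s e := by
    change Abelian.Ext.comp (show Abelian.Ext.{u} (leftRestrict φ) (ModuleCat.of R R) n from e)
      (Abelian.Ext.mk₀ (rightMulSelf (s.unop * r.unop))) _ = _
    rw [rightMulSelf_mul, ← Abelian.Ext.mk₀_comp_mk₀]
    exact (Abelian.Ext.comp_assoc_of_third_deg_zero _ _ _ _).symm
  smul_zero r := Abelian.Ext.zero_comp (X := leftRestrict φ) (Y := ModuleCat.of R R) (n := n)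
    (Abelian.Ext.mk₀ (rightMulSelf r.unop)) n (add_zero n)
  smul_add r e e' := Abelian.Ext.add_comp _ _ _ _
  add_smul r s e := by
    change Abelian.Ext.comp (show Abelian.Ext.{u} (leftRestrict φ) (ModuleCat.of R R) n from e)
      (Abelian.Ext.mk₀ (rightMulSelf (r.unop + s.unop))) _ = _
    rw [rightMulSelf_add, Abelian.Ext.mk₀_add]; exact Abelian.Ext.comp_add _ _ _ _
  zero_smul e := by
    change Abelian.Ext.comp (show Abelian.Ext.{u} (leftRestrict φ) (ModuleCat.of R R) n from e)
      (Abelian.Ext.mk₀ (rightMulSelf 0)) _ = _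
    rw [rightMulSelf_zero, Abelian.Ext.mk₀_zero]; exact Abelian.Ext.comp_zero _ _ _ _ _

instance (n : ℕ) : SMulCommClass A Rᵐᵒᵖ (ExtAR φ n) where
  smul_comm _ _ _ := (Abelian.Ext.comp_assoc_of_third_deg_zero _ _ _ _).symm

/-- The right `R`-module `X ⊗_A Hom_R(A, R)`. -/
def tensorHom (X : ModuleCat.{u} Aᵐᵒᵖ) : ModuleCat.{u} Rᵐᵒᵖ := tensor A R X (HomAR φ)

/-- The right `R`-module `X ⊗_A Ext^n_R(A, R)`. -/
def tensorExt (X : ModuleCat.{u} Aᵐᵒᵖ) (n : ℕ) : ModuleCat.{u} Rᵐᵒᵖ := tensor A R X (ExtAR φ n)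

end Change

/-- There is a short exact sequence `0 ⟶ X ⟶ Y ⟶ Z ⟶ 0`. -/
def ExistsShortExact {S : Type u} [Ring S] (X Y Z : ModuleCat.{u} S) : Prop :=
  ∃ (i : X ⟶ Y) (q : Y ⟶ Z),
    Function.Injective i ∧ Function.Exact i q ∧ Function.Surjective q

end GorTranspose

end

/-!
The Gorenstein transposes are read off from an exact sequence
`0 ⟶ L_n ⟶ G₁ ⟶ G₀ ⟶ Ω^n_R(M) ⟶ 0` obtained from `0 ⟶ ker f ⟶ P₁ ⟶ P₀ ⟶ M ⟶ 0` by applying the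
horseshoe construction `n` times over `R` (`IsFourTerm.nonempty_horseshoe`). The construction starts
from arbitrary prescribed covers of the two end terms, so every choice of `Ω^n_R(M)`, of
`Ω^{n-2}_R(ker f)` and of a presentation of the latter is reached. The modules `G₁` and `G₀` are
`n`-th syzygies of `P₁` and `P₀` over `R`.

*Gorenstein projectivity of `G₁` and `G₀`.* Let `VanishAbove d X` say that `Ext^j(X, -)` vanishes,
for `j > d`, on all iterated syzygies of injective modules. This holds with `d = 0` for Gorenstein
projective `X`, by shifting along a totally acyclic complex, hence for `A` with `d` a bound for its
Gorenstein projective dimension, and it passes to syzygies, cosyzygies and direct summands by long exact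
sequences. Conversely let `X` be finitely generated with `Ext^j(X, R) = 0` for `j > 0` and
`VanishAbove d X` for some `d`. Dimension shifting makes `d = 0` possible. Then `Ext¹(X, -)` vanishes
on a syzygy of an injective module `I` containing `X`, so `X ⟶ I` lifts to a projective cover of `I`
and `X` is torsionless. Its approximation by a free module is therefore injective with a cokernel of
the same kind, and a totally acyclic complex is spliced together
(`HasGorensteinVanishing.isGorensteinProjective`).

*The exact sequence.* Write `-^*` for `Hom_R(-, R)`. In the last horseshoe, with projective row
`0 ⟶ Q ⟶ C₁ ⟶ C₀ ⟶ F ⟶ 0` and with `P₁'`, `P₀'` the syzygies of `P₁`, `P₀` that it covers, the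
cokernel of `C_i^* ⟶ G_i^*` is `Ext¹(P_i', R) = Ext^n(P_i, R)`. The snake lemma gives
`Q^* ⟶ Coker(G₀^* ⟶ G₁^*) ⟶ Coker Ext^n(f, R) ⟶ 0` (`Horseshoe.exists_exact_dualCoker`). Since
`Ext^i_R(A, R) = 0` for `i < n`, also `Ext^i_R(X, R) = 0` for `i < n` and every finitely generated
`A`-module `X`; this identifies the kernel of the first map, as zero for `n = 1` and as the image of
the dual of the presentation of `Ω^{n-2}_R(ker f)` for `n ≥ 2`, and it bounds the projective
dimension of the transpose by dualizing a projective resolution of `ker f`.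

*The right-hand term.* For a contravariant additive functor `F` on `A`-modules, `Coker F(f)` is
`Coker Hom_A(f, A) ⊗_A F(A)` (`nonempty_tensor_dualCoker_equiv`). With `F = Hom_R(-, R)` this is the
case `n = 0`, and with `F = Ext^n_R(-, R)` it gives the right-hand term of the sequences.
-/

noncomputable section

namespace GorTranspose

/-! ### Short exact sequences of modules and vanishing of Ext -/

section ShortExact

open Abelian Abelian.Ext

variable {R : Type u} [Ring R]

/-- `0 ⟶ X ⟶ Y ⟶ Z ⟶ 0` is a short exact sequence of modules, stated elementwise. -/
structure IsSES {X Y Z : ModuleCat.{u} R} (i : X ⟶ Y) (p : Y ⟶ Z) : Prop where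
  injective : Function.Injective i
  exact : Function.Exact i p
  surjective : Function.Surjective p

variable {X Y Z W : ModuleCat.{u} R} {i : X ⟶ Y} {p : Y ⟶ Z}

theorem comp_eq_zero_of_exact (h : Function.Exact i p) : i ≫ p = 0 := by
  ext x
  exact (h (i x)).2 ⟨x, rfl⟩

theorem IsSES.shortExact (h : IsSES i p) :
    (ShortComplex.mk i p (comp_eq_zero_of_exact h.exact)).ShortExact :=
  ModuleCat.shortComplex_shortExact _ h.exact h.injective h.surjective

/-- The class in `Ext¹` of a short exact sequence of modules. -/
def IsSES.extClass (h : IsSES i p) : Ext.{u} Z X 1 := h.shortExact.extClass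

theorem IsSES.ext_left (h : IsSES i p) (n : ℕ) (h₂ : Subsingleton (Ext.{u} Y W n))
    (h₃ : Subsingleton (Ext.{u} Z W (n + 1))) : Subsingleton (Ext.{u} X W n) := by
  refine subsingleton_of_forall_eq 0 fun e => ?_
  obtain ⟨e', rfl⟩ := contravariant_sequence_exact₁ h.shortExact W e (add_comm 1 n)
    (Subsingleton.elim _ _)
  rw [Subsingleton.elim e' 0, comp_zero]

theorem IsSES.ext_right (h : IsSES i p) (n : ℕ) (h₁ : Subsingleton (Ext.{u} X W n))
    (h₂ : Subsingleton (Ext.{u} Y W (n + 1))) : Subsingleton (Ext.{u} Z W (n + 1)) := by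
  refine subsingleton_of_forall_eq 0 fun e => ?_
  obtain ⟨e', rfl⟩ := contravariant_sequence_exact₃ h.shortExact W e
    (Subsingleton.elim _ _) (add_comm 1 n)
  rw [Subsingleton.elim e' 0, comp_zero]

theorem IsSES.ext_left₂ (h : IsSES i p) (n : ℕ) (h₂ : Subsingleton (Ext.{u} W Y (n + 1)))
    (h₃ : Subsingleton (Ext.{u} W Z n)) : Subsingleton (Ext.{u} W X (n + 1)) := by
  refine subsingleton_of_forall_eq 0 fun e => ?_
  obtain ⟨e', rfl⟩ := covariant_sequence_exact₁ W h.shortExact e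
    (Subsingleton.elim _ _) rfl
  rw [Subsingleton.elim e' 0, zero_comp]

theorem IsSES.ext_right₂ (h : IsSES i p) (n : ℕ) (h₁ : Subsingleton (Ext.{u} W X (n + 1)))
    (h₂ : Subsingleton (Ext.{u} W Y n)) : Subsingleton (Ext.{u} W Z n) := by
  refine subsingleton_of_forall_eq 0 fun e => ?_
  obtain ⟨e', rfl⟩ := covariant_sequence_exact₃ W h.shortExact e rfl
    (Subsingleton.elim _ _)
  rw [Subsingleton.elim e' 0, zero_comp]

theorem IsSES.exists_extension (h : IsSES i p) (h₃ : Subsingleton (Ext.{u} Z W 1)) (g : X ⟶ W) :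
    ∃ g' : Y ⟶ W, i ≫ g' = g := by
  obtain ⟨e, he⟩ := contravariant_sequence_exact₁ h.shortExact W (mk₀ g) (add_zero 1)
    (Subsingleton.elim _ _)
  obtain ⟨g', rfl⟩ := (mk₀_bijective _ _).2 e
  exact ⟨g', (mk₀_bijective _ _).1 (by rw [← he, mk₀_comp_mk₀])⟩

theorem IsSES.exists_lift (h : IsSES i p) (h₁ : Subsingleton (Ext.{u} W X 1)) (g : W ⟶ Z) :
    ∃ g' : W ⟶ Y, g' ≫ p = g := by
  obtain ⟨e, he⟩ := covariant_sequence_exact₃ W h.shortExact (mk₀ g) rfl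
    (Subsingleton.elim _ _)
  obtain ⟨g', rfl⟩ := (mk₀_bijective _ _).2 e
  exact ⟨g', (mk₀_bijective _ _).1 (by rw [← he, mk₀_comp_mk₀])⟩

theorem IsSES.ext_one_of_extension (h : IsSES i p) (h₂ : Subsingleton (Ext.{u} Y W 1))
    (he : ∀ g : X ⟶ W, ∃ g' : Y ⟶ W, i ≫ g' = g) : Subsingleton (Ext.{u} Z W 1) := by
  refine subsingleton_of_forall_eq 0 fun e => ?_
  obtain ⟨e', rfl⟩ := contravariant_sequence_exact₃ h.shortExact W e
    (Subsingleton.elim _ _) (add_zero 1)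
  obtain ⟨g, rfl⟩ := (mk₀_bijective _ _).2 e'
  obtain ⟨g', rfl⟩ := he g
  rw [← mk₀_comp_mk₀, ← comp_assoc_of_second_deg_zero,
    show h.shortExact.extClass.comp (mk₀ i) (add_zero 1) = 0 from h.shortExact.extClass_comp,
    zero_comp]

theorem ext_of_projective (hX : Module.Projective R X) (W : ModuleCat.{u} R) (n : ℕ) :
    Subsingleton (Ext.{u} X W (n + 1)) :=
  subsingleton_of_projective X W n

theorem isSES_ker (p : Y ⟶ Z) (hp : Function.Surjective p) :
    IsSES (ModuleCat.ofHom (LinearMap.ker p.hom).subtype) p :=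
  ⟨Subtype.val_injective, fun y => by
    constructor
    · intro hy; exact ⟨⟨y, hy⟩, rfl⟩
    · rintro ⟨y, rfl⟩; exact y.2, hp⟩

theorem isSES_coker (i : X ⟶ Y) (hi : Function.Injective i) :
    IsSES i (ModuleCat.ofHom (LinearMap.range i.hom).mkQ) :=
  ⟨hi, fun y => by
    change Submodule.Quotient.mk y = _ ↔ _
    rw [Submodule.Quotient.mk_eq_zero]; rfl, Submodule.mkQ_surjective _⟩

/-- A map killed by `i` factors uniquely through the cokernel `p`. -/
theorem exists_desc (hp : Function.Exact i p) (hs : Function.Surjective p) (g : Y ⟶ W)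
    (hg : i ≫ g = 0) : ∃ g' : Z ⟶ W, p ≫ g' = g := by
  have hk : LinearMap.ker p.hom ≤ LinearMap.ker g.hom := by
    intro y hy
    obtain ⟨x, rfl⟩ := (hp y).1 hy
    exact congrArg (fun k : X ⟶ W => k x) hg
  refine ⟨ModuleCat.ofHom ((LinearMap.ker p.hom).liftQ g.hom hk ∘ₗ
    (p.hom.quotKerEquivOfSurjective hs).symm.toLinearMap), ?_⟩
  ext y
  have : (p.hom.quotKerEquivOfSurjective hs).symm (p.hom y) = Submodule.Quotient.mk y := by
    rw [LinearEquiv.symm_apply_eq]; rfl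
  change (LinearMap.ker p.hom).liftQ g.hom hk
    ((p.hom.quotKerEquivOfSurjective hs).symm (p.hom y)) = _
  rw [this]; rfl

/-- A map killed by `p` factors through the kernel `i`. -/
theorem exists_ker_lift (hp : Function.Exact i p) (hi : Function.Injective i) (g : W ⟶ Y)
    (hg : g ≫ p = 0) : ∃ g' : W ⟶ X, g' ≫ i = g := by
  have hk : ∀ w, g.hom w ∈ LinearMap.range i.hom := fun w =>
    (hp _).1 (congrArg (fun k : W ⟶ Z => k w) hg)
  refine ⟨ModuleCat.ofHom ((LinearEquiv.ofInjective i.hom hi).symm.toLinearMap ∘ₗ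
    g.hom.codRestrict _ hk), ?_⟩
  ext w
  change i.hom ((LinearEquiv.ofInjective i.hom hi).symm (g.hom.codRestrict _ hk w)) = _
  exact congrArg Subtype.val
    ((LinearEquiv.ofInjective i.hom hi).apply_symm_apply (g.hom.codRestrict _ hk w))

theorem exists_projective_lift (hW : Module.Projective R W) (hs : Function.Surjective p)
    (g : W ⟶ Z) : ∃ g' : W ⟶ Y, g' ≫ p = g := by
  obtain ⟨k, hk⟩ := Module.projective_lifting_property p.hom g.hom hs
  exact ⟨ModuleCat.ofHom k, by ext w; exact LinearMap.congr_fun hk w⟩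

/-- Every finitely generated module is a quotient of a finitely generated free module. -/
theorem exists_free_cover (X : ModuleCat.{u} R) (hX : Module.Finite R X) :
    ∃ (F : ModuleCat.{u} R) (p : F ⟶ X), Module.Finite R F ∧ Module.Projective R F ∧
      Function.Surjective p := by
  obtain ⟨n, f, hf⟩ := Module.Finite.exists_fin' R X
  exact ⟨ModuleCat.of R (Fin n → R), ModuleCat.ofHom f, inferInstanceAs (Module.Finite R (Fin n → R)),
    inferInstanceAs (Module.Projective R (Fin n → R)), hf⟩

theorem exists_projective_cover (X : ModuleCat.{u} R) :
    ∃ (F : ModuleCat.{u} R) (p : F ⟶ X), Module.Projective R F ∧ Function.Surjective p :=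
  ⟨ModuleCat.of R (X →₀ R), ModuleCat.ofHom (Finsupp.linearCombination R id),
    inferInstanceAs (Module.Projective R (X →₀ R)), Finsupp.linearCombination_id_surjective R X⟩

end ShortExact

/-! ### A criterion for Gorenstein projectivity -/

section Gorenstein

open Abelian Abelian.Ext

variable {R : Type u} [Ring R]

/-- Iterated syzygies of injective modules, along arbitrary projective modules. -/
inductive IsInjSyzygy : ModuleCat.{u} R → Prop
  | injective (I : ModuleCat.{u} R) (h : Injective I) : IsInjSyzygy I
  | syzygy (Z Q Y : ModuleCat.{u} R) (i : Z ⟶ Q) (p : Q ⟶ Y) (hQ : Module.Projective R Q)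
      (h : IsSES i p) (hY : IsInjSyzygy Y) : IsInjSyzygy Z

/-- `VanishAbove d X`: the functor `Ext^j(X, -)` vanishes for `j > d` on all iterated syzygies of
injective modules. Unlike finiteness of the Gorenstein projective dimension, this condition passes
through long exact sequences and to direct summands for trivial reasons. -/
def VanishAbove (d : ℕ) (X : ModuleCat.{u} R) : Prop :=
  ∀ Z : ModuleCat.{u} R, IsInjSyzygy Z → ∀ j, d < j → Subsingleton (Ext.{u} X Z j)

theorem VanishAbove.mono {d e : ℕ} {X : ModuleCat.{u} R} (h : VanishAbove d X) (hde : d ≤ e) :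
    VanishAbove e X := fun Z hZ j hj => h Z hZ j (hde.trans_lt hj)

theorem VanishAbove.of_projective {X : ModuleCat.{u} R} (hX : Module.Projective R X) :
    VanishAbove 0 X := fun Z _ j hj => by
  obtain ⟨j, rfl⟩ := Nat.exists_eq_succ_of_ne_zero hj.ne'
  exact ext_of_projective hX Z j

theorem VanishAbove.left {d : ℕ} {X Y Z : ModuleCat.{u} R} {i : X ⟶ Y} {p : Y ⟶ Z}
    (h : IsSES i p) (hY : VanishAbove d Y) (hZ : VanishAbove d Z) : VanishAbove d X :=
  fun W hW j hj => h.ext_left j (hY W hW j hj) (hZ W hW (j + 1) (by omega))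

theorem VanishAbove.right {d : ℕ} {X Y Z : ModuleCat.{u} R} {i : X ⟶ Y} {p : Y ⟶ Z}
    (h : IsSES i p) (hX : VanishAbove d X) (hY : VanishAbove (d + 1) Y) : VanishAbove (d + 1) Z :=
  fun W hW j hj => by
    obtain ⟨j, rfl⟩ := Nat.exists_eq_succ_of_ne_zero (show j ≠ 0 by omega)
    exact h.ext_right j (hX W hW j (by omega)) (hY W hW (j + 1) hj)

section TotallyAcyclic

variable {P : ℤ → ModuleCat.{u} R} {d : ∀ i, P (i + 1) ⟶ P i}

theorem IsTotallyAcyclic.isSES (h : IsTotallyAcyclic P d) (i : ℤ) :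
    IsSES (ModuleCat.ofHom (LinearMap.range (d (i + 1)).hom).subtype)
      (ModuleCat.ofHom (d i).hom.rangeRestrict) :=
  ⟨Subtype.val_injective, fun y => by
    constructor
    · intro hy
      obtain ⟨x, rfl⟩ := (h.acyclic i y).1 (congrArg Subtype.val hy)
      exact ⟨⟨_, ⟨x, rfl⟩⟩, rfl⟩
    · rintro ⟨⟨_, ⟨x, rfl⟩⟩, rfl⟩
      exact Subtype.ext ((h.acyclic i _).2 ⟨x, rfl⟩), (d i).hom.surjective_rangeRestrict⟩

theorem IsTotallyAcyclic.ext_projective (h : IsTotallyAcyclic P d) (Q : ModuleCat.{u} R)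
    (hQ : Module.Projective R Q) (j : ℕ) (i : ℤ) :
    Subsingleton (Ext.{u} (ModuleCat.of R (LinearMap.range (d i).hom)) Q (j + 1)) := by
  induction j generalizing i with
  | zero =>
    refine (h.isSES i).ext_one_of_extension (ext_of_projective (h.projective _) _ 0) fun g => ?_
    obtain ⟨k, hk⟩ := (h.hom_acyclic Q hQ (i + 1)
      (ModuleCat.ofHom (d (i + 1)).hom.rangeRestrict ≫ g)).1 (by
        ext x
        have : (d (i + 1)).hom.rangeRestrict (d (i + 1 + 1) x) = 0 :=
          Subtype.ext ((h.acyclic (i + 1) _).2 ⟨x, rfl⟩)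
        change g.hom ((d (i + 1)).hom.rangeRestrict (d (i + 1 + 1) x)) = 0
        rw [this, map_zero])
    refine ⟨k, ?_⟩
    ext ⟨_, ⟨x, rfl⟩⟩
    exact congrArg (fun l : P (i + 1 + 1) ⟶ Q => l x) hk
  | succ j ih =>
    exact (h.isSES i).ext_right (j + 1) (ih (i + 1)) (ext_of_projective (h.projective _) _ _)

theorem IsTotallyAcyclic.ext_injSyzygy (h : IsTotallyAcyclic P d) {Z : ModuleCat.{u} R}
    (hZ : IsInjSyzygy Z) (j : ℕ) (i : ℤ) :
    Subsingleton (Ext.{u} (ModuleCat.of R (LinearMap.range (d i).hom)) Z (j + 1)) := by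
  induction hZ generalizing j i with
  | injective I hI => exact subsingleton_of_injective _ I j
  | syzygy Z Q Y _ _ hQ hs _ ih =>
    obtain ⟨i, rfl⟩ : ∃ k, i = k + 1 := ⟨i - 1, by ring⟩
    refine (h.isSES i).ext_left (j + 1) (ext_of_projective (h.projective _) _ _) ?_
    exact hs.ext_left₂ (j + 1) (h.ext_projective Q hQ _ i) (ih j i)

end TotallyAcyclic

theorem ext_of_retract {X X' W : ModuleCat.{u} R} {n : ℕ} (f : X ⟶ X') (g : X' ⟶ X)
    (hfg : f ≫ g = 𝟙 X) (h : Subsingleton (Ext.{u} X' W n)) : Subsingleton (Ext.{u} X W n) := by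
  refine subsingleton_of_forall_eq 0 fun e => ?_
  rw [← mk₀_id_comp e, ← hfg, ← mk₀_comp_mk₀_assoc,
    Subsingleton.elim ((mk₀ g).comp e (zero_add n)) 0, comp_zero]

theorem IsGorensteinProjective.vanishAbove {X : ModuleCat.{u} R} (h : IsGorensteinProjective X) :
    VanishAbove 0 X := by
  obtain ⟨P, d, hP, ⟨e⟩⟩ := h
  intro Z hZ j hj
  obtain ⟨j, rfl⟩ := Nat.exists_eq_succ_of_ne_zero hj.ne'
  exact ext_of_retract (ModuleCat.ofHom e.toLinearMap) (ModuleCat.ofHom e.symm.toLinearMap)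
    (by ext x; exact e.symm_apply_apply x) (hP.ext_injSyzygy hZ j 0)

theorem GpdLE.vanishAbove {m : ℕ} {X : ModuleCat.{u} R} (h : GpdLE m X) : VanishAbove m X := by
  induction h with
  | zero M h => exact h.vanishAbove
  | succ n M K G i p hG hi he hs _ ih =>
    exact VanishAbove.right ⟨hi, he, hs⟩ ih (hG.vanishAbove.mono (Nat.zero_le _))

/-- The finitely generated modules to which the Gorenstein projectivity criterion
`HasGorensteinVanishing.isGorensteinProjective` applies. -/
structure HasGorensteinVanishing (X : ModuleCat.{u} R) : Prop where
  finite : Module.Finite R X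
  ext : ∀ j, Subsingleton (Ext.{u} X (ModuleCat.of R R) (j + 1))
  vanish : ∃ d, VanishAbove d X

theorem finite_of_injective [IsNoetherianRing R] {X Y : ModuleCat.{u} R} (i : X ⟶ Y)
    (hi : Function.Injective i) (hY : Module.Finite R Y) : Module.Finite R X :=
  Module.Finite.of_injective i.hom hi

theorem finite_of_surjective {X Y : ModuleCat.{u} R} (p : X ⟶ Y)
    (hp : Function.Surjective p) (hX : Module.Finite R X) : Module.Finite R Y :=
  Module.Finite.of_surjective p.hom hp

/-- If every functional on the finitely generated module `X` extends along `i`, so does every map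
to a projective module `Q`: the image of `X` in a free module containing `Q` has finitely many
nonzero coordinates. -/
theorem exists_extension_of_projective {X Y Q : ModuleCat.{u} R} (i : X ⟶ Y)
    (hX : Module.Finite R X) (hQ : Module.Projective R Q)
    (h : ∀ g : X ⟶ ModuleCat.of R R, ∃ g' : Y ⟶ ModuleCat.of R R, i ≫ g' = g) (g : X ⟶ Q) :
    ∃ g' : Y ⟶ Q, i ≫ g' = g := by
  classical
  obtain ⟨s, hs⟩ := hQ.out
  obtain ⟨S, hS⟩ := hX.fg_top
  set B : Finset Q := S.biUnion fun x => (s (g x)).support with hB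
  have hsupp : ∀ x : X, s (g x) ∈ Finsupp.supported R R (B : Set Q) := by
    have : Submodule.span R (S : Set X) ≤
        (Finsupp.supported R R (B : Set Q)).comap (s ∘ₗ g.hom) := by
      rw [Submodule.span_le]
      intro x hx
      change s (g x) ∈ Finsupp.supported R R (B : Set Q)
      rw [Finsupp.mem_supported]
      exact_mod_cast Finset.subset_biUnion_of_mem (fun x => (s (g x)).support) hx
    intro x
    exact this (hS ▸ Submodule.mem_top)
  choose c hc using fun b : Q => h (ModuleCat.ofHom (Finsupp.lapply b ∘ₗ s ∘ₗ g.hom))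
  refine ⟨ModuleCat.ofHom (∑ b ∈ B, (LinearMap.toSpanSingleton R Q b) ∘ₗ (c b).hom), ?_⟩
  ext x
  have hcb : ∀ b, (c b).hom (i.hom x) = s (g.hom x) b := fun b =>
    congrArg (fun k : X ⟶ ModuleCat.of R R => k x) (hc b)
  have key : Finsupp.linearCombination R id (s (g.hom x)) = ∑ b ∈ B, (s (g.hom x) b) • b :=
    Finsupp.linearCombination_apply_of_mem_supported R (hsupp x)
  change (∑ b ∈ B, (LinearMap.toSpanSingleton R Q b) ∘ₗ (c b).hom) (i.hom x) = g.hom x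
  rw [LinearMap.sum_apply]
  simp only [LinearMap.comp_apply, LinearMap.toSpanSingleton_apply]
  rw [Finset.sum_congr rfl fun b _ => by rw [hcb b]]
  exact key.symm.trans (hs _)

theorem ext_projective_of_ext_self [IsNoetherianRing R] {X Q : ModuleCat.{u} R}
    (hX : Module.Finite R X) (h : ∀ j, Subsingleton (Ext.{u} X (ModuleCat.of R R) (j + 1)))
    (hQ : Module.Projective R Q) (j : ℕ) : Subsingleton (Ext.{u} X Q (j + 1)) := by
  induction j generalizing X with
  | zero =>
    obtain ⟨F, p, hF, hF', hp⟩ := exists_free_cover X hX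
    have hs := isSES_ker p hp
    exact hs.ext_one_of_extension (ext_of_projective hF' _ 0)
      (exists_extension_of_projective _ (finite_of_injective _ hs.injective hF) hQ
        (hs.exists_extension (h 0)))
  | succ j ih =>
    obtain ⟨F, p, hF, hF', hp⟩ := exists_free_cover X hX
    have hs := isSES_ker p hp
    exact hs.ext_right (j + 1) (ih (finite_of_injective _ hs.injective hF) fun j =>
      hs.ext_left (j + 1) (ext_of_projective hF' _ j) (h (j + 1)))
      (ext_of_projective hF' _ _)

namespace HasGorensteinVanishing

variable {X : ModuleCat.{u} R}

theorem vanishAbove_zero [IsNoetherianRing R] (h : HasGorensteinVanishing X) :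
    VanishAbove 0 X := by
  obtain ⟨d, hd⟩ := h.vanish
  induction d with
  | zero => exact hd
  | succ d ih =>
    refine ih fun Z hZ j hj => ?_
    obtain ⟨Q, p, hQ, hp⟩ := exists_projective_cover Z
    have hs := isSES_ker p hp
    obtain ⟨k, rfl⟩ := Nat.exists_eq_succ_of_ne_zero (show j ≠ 0 by omega)
    exact hs.ext_right₂ (k + 1) (hd _ (.syzygy _ Q Z _ p hQ hs hZ) _ (by omega))
      (ext_projective_of_ext_self h.finite h.ext hQ k)

/-- An embedding of `X` into an injective module `I` lifts to any projective cover of `I`, since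
`Ext¹` from `X` to a syzygy of `I` vanishes. -/
theorem exists_embedding [IsNoetherianRing R] (h : HasGorensteinVanishing X) :
    ∃ (Q : ModuleCat.{u} R) (i : X ⟶ Q), Module.Projective R Q ∧ Function.Injective i := by
  obtain ⟨Q, p, hQ, hp⟩ := exists_projective_cover (Injective.under X)
  have hs := isSES_ker p hp
  obtain ⟨i, hi⟩ := hs.exists_lift (h.vanishAbove_zero _
    (.syzygy _ Q _ _ p hQ hs (.injective _ inferInstance)) 1 one_pos) (Injective.ι X)
  have hinj : Function.Injective (i ≫ p) := by
    rw [hi]; exact (ModuleCat.mono_iff_injective _).1 inferInstance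
  exact ⟨Q, i, hQ, fun x y hxy => hinj (congrArg p hxy)⟩

theorem eq_zero_of_forall_functional [IsNoetherianRing R] (h : HasGorensteinVanishing X) (x : X)
    (hx : ∀ g : X →ₗ[R] R, g x = 0) : x = 0 := by
  obtain ⟨Q, i, hQ, hi⟩ := h.exists_embedding
  obtain ⟨s, hs⟩ := hQ.out
  have : s (i.hom x) = 0 := Finsupp.ext fun b => hx (Finsupp.lapply b ∘ₗ s ∘ₗ i.hom)
  refine hi ?_
  have h2 := hs (i.hom x)
  rw [this, map_zero] at h2
  exact h2.symm.trans (map_zero i.hom).symm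

theorem exists_syzygy [IsNoetherianRing R] (h : HasGorensteinVanishing X) :
    ∃ (Y F : ModuleCat.{u} R) (i : Y ⟶ F) (p : F ⟶ X), Module.Projective R F ∧
      Module.Finite R F ∧ IsSES i p ∧ HasGorensteinVanishing Y := by
  obtain ⟨F, p, hF, hF', hp⟩ := exists_free_cover X h.finite
  have hs := isSES_ker p hp
  exact ⟨_, F, _, p, hF', hF, hs, finite_of_injective _ hs.injective hF,
    fun j => hs.ext_left (j + 1) (ext_of_projective hF' _ j) (h.ext (j + 1)), 0,
    VanishAbove.left hs (.of_projective hF') h.vanishAbove_zero⟩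

end HasGorensteinVanishing

instance [IsNoetherianRing Rᵐᵒᵖ] : IsNoetherian Rᵐᵒᵖ R :=
  isNoetherian_of_linearEquiv (M := Rᵐᵒᵖ)
    ({ toFun := MulOpposite.unop, invFun := MulOpposite.op, map_add' := fun _ _ => rfl,
       map_smul' := fun _ _ => rfl, left_inv := fun _ => rfl, right_inv := fun _ => rfl } :
      Rᵐᵒᵖ ≃ₗ[Rᵐᵒᵖ] R)

/-- The dual of a finitely generated left module is a finitely generated right module, when the
ring is Noetherian on the right. -/
theorem finite_dual [IsNoetherianRing Rᵐᵒᵖ] (X : ModuleCat.{u} R) (hX : Module.Finite R X) :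
    Module.Finite Rᵐᵒᵖ (X →ₗ[R] R) := by
  obtain ⟨n, f, hf⟩ := Module.Finite.exists_fin' R X
  let ev : (X →ₗ[R] R) →ₗ[Rᵐᵒᵖ] (Fin n → R) :=
    { toFun := fun g k => g (f (Pi.single k 1)), map_add' := fun _ _ => rfl
      map_smul' := fun _ _ => rfl }
  refine Module.Finite.of_injective ev fun g g' h => ?_
  have : g ∘ₗ f = g' ∘ₗ f := LinearMap.pi_ext' fun k => LinearMap.ext_ring (congrFun h k)
  ext x
  obtain ⟨y, rfl⟩ := hf x
  exact LinearMap.congr_fun this y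

/-- A map to a finitely generated free module through which every functional factors. -/
theorem exists_left_approximation [IsNoetherianRing Rᵐᵒᵖ] (X : ModuleCat.{u} R)
    (hX : Module.Finite R X) :
    ∃ (F : ModuleCat.{u} R) (i : X ⟶ F), Module.Finite R F ∧ Module.Projective R F ∧
      Function.Surjective (dualMap i) := by
  obtain ⟨S, hS⟩ := (finite_dual X hX).fg_top
  refine ⟨ModuleCat.of R (S → R), ModuleCat.ofHom (LinearMap.pi fun h => h.1),
    inferInstanceAs (Module.Finite R (S → R)), inferInstanceAs (Module.Projective R (S → R)), ?_⟩
  rw [← LinearMap.range_eq_top, ← top_le_iff, ← hS, Submodule.span_le]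
  intro h hh
  exact ⟨LinearMap.proj ⟨h, hh⟩, rfl⟩

variable [IsNoetherianRing R] [IsNoetherianRing Rᵐᵒᵖ] {X : ModuleCat.{u} R}

theorem HasGorensteinVanishing.exists_cosyzygy (h : HasGorensteinVanishing X) :
    ∃ (Y F : ModuleCat.{u} R) (i : X ⟶ F) (p : F ⟶ Y), Module.Projective R F ∧
      Module.Finite R F ∧ IsSES i p ∧ HasGorensteinVanishing Y := by
  obtain ⟨F, i, hF, hF', hi⟩ := exists_left_approximation X h.finite
  have hinj : Function.Injective i.hom := by
    rw [injective_iff_map_eq_zero]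
    intro x hx
    refine h.eq_zero_of_forall_functional x fun g => ?_
    obtain ⟨k, rfl⟩ := hi g
    change k (i.hom x) = 0
    rw [hx, map_zero]
  have hs := isSES_coker i hinj
  refine ⟨_, F, i, _, hF', hF, hs, finite_of_surjective _ hs.surjective hF, fun j => ?_, 1,
    VanishAbove.right hs h.vanishAbove_zero ((VanishAbove.of_projective hF').mono zero_le_one)⟩
  cases j with
  | zero =>
    refine hs.ext_one_of_extension (ext_of_projective hF' _ 0) fun g => ?_
    obtain ⟨k, hk⟩ := hi g.hom
    exact ⟨ModuleCat.ofHom k, ModuleCat.hom_ext hk⟩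
  | succ j => exact hs.ext_right (j + 1) (h.ext j) (ext_of_projective hF' _ _)

theorem exists_int_chain {α : Type*} (r : α → α → Prop) (h₁ : ∀ x, ∃ y, r x y)
    (h₂ : ∀ y, ∃ x, r x y) (x : α) : ∃ s : ℤ → α, s 0 = x ∧ ∀ i, r (s i) (s (i + 1)) := by
  choose f hf using h₁
  choose g hg using h₂
  refine ⟨fun i => match i with
    | Int.ofNat n => f^[n] x
    | Int.negSucc n => g^[n + 1] x, rfl, fun i => ?_⟩
  match i with
  | Int.ofNat n =>
    change r (f^[n] x) (f^[n + 1] x)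
    rw [Function.iterate_succ_apply']
    exact hf _
  | Int.negSucc 0 => exact hg x
  | Int.negSucc (n + 1) =>
    change r (g^[n + 1 + 1] x) (g^[n + 1] x)
    rw [Function.iterate_succ_apply' g (n + 1)]
    exact hg _

/-- The totally acyclic complex is spliced from syzygies and from cokernels of approximations by
free modules. -/
theorem HasGorensteinVanishing.isGorensteinProjective (h : HasGorensteinVanishing X) :
    IsGorensteinProjective X := by
  obtain ⟨t, ht0, ht⟩ := exists_int_chain
    (α := {Y : ModuleCat.{u} R // HasGorensteinVanishing Y})
    (fun Z Y => ∃ (F : ModuleCat.{u} R) (i : Y.1 ⟶ F) (p : F ⟶ Z.1), Module.Projective R F ∧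
      Module.Finite R F ∧ IsSES i p)
    (fun Z => by
      obtain ⟨Y, F, i, p, h1, h2, h3, h4⟩ := Z.2.exists_syzygy
      exact ⟨⟨Y, h4⟩, F, i, p, h1, h2, h3⟩)
    (fun Y => by
      obtain ⟨Z, F, i, p, h1, h2, h3, h4⟩ := Y.2.exists_cosyzygy
      exact ⟨⟨Z, h4⟩, F, i, p, h1, h2, h3⟩) ⟨X, h⟩
  -- The chain is shifted so that `X` sits at the index `1`, the image of the differential `d 0`.
  obtain ⟨s, hs1, hs⟩ : ∃ s : ℤ → {Y : ModuleCat.{u} R // HasGorensteinVanishing Y},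
      s (0 + 1) = ⟨X, h⟩ ∧ ∀ k, ∃ (F : ModuleCat.{u} R) (i : (s (k + 1)).1 ⟶ F) (p : F ⟶ (s k).1),
        Module.Projective R F ∧ Module.Finite R F ∧ IsSES i p := by
    refine ⟨fun k => t (k - 1), by simpa using ht0, fun k => ?_⟩
    have := ht (k - 1)
    rwa [show k - 1 + 1 = k + 1 - 1 by ring] at this
  choose F i p hF hF' hip using hs
  refine ⟨F, fun k => p (k + 1) ≫ i k, ⟨hF, fun k y => ?_, fun Q hQ k g => ?_⟩, ?_⟩
  · constructor
    · intro hy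
      have h1 : p (k + 1) y = 0 :=
        (hip k).injective ((show i k (p (k + 1) y) = 0 from hy).trans (map_zero (i k).hom).symm)
      obtain ⟨z, rfl⟩ := ((hip (k + 1)).exact y).1 h1
      obtain ⟨w, rfl⟩ := (hip (k + 1 + 1)).surjective z
      exact ⟨w, rfl⟩
    · rintro ⟨w, rfl⟩
      change i k (p (k + 1) (i (k + 1) (p (k + 1 + 1) w))) = 0
      rw [((hip (k + 1)).exact _).2 ⟨_, rfl⟩]
      exact map_zero (i k).hom
  · have h0 : ∀ k, i (k + 1) ≫ p (k + 1) = 0 := fun k => comp_eq_zero_of_exact (hip (k + 1)).exact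
    constructor
    · intro hg
      have hg' : i (k + 1) ≫ g = 0 := by
        ext z
        obtain ⟨w, rfl⟩ := (hip (k + 1 + 1)).surjective z
        exact congrArg (fun l : F (k + 1 + 1) ⟶ Q => l w) hg
      obtain ⟨g₁, rfl⟩ := exists_desc (hip (k + 1)).exact (hip (k + 1)).surjective g hg'
      obtain ⟨g₂, rfl⟩ := (hip k).exists_extension
        (ext_projective_of_ext_self (s k).2.finite (s k).2.ext hQ 0) g₁
      exact ⟨g₂, Category.assoc _ _ _⟩
    · rintro ⟨g', rfl⟩
      change (p (k + 1 + 1) ≫ i (k + 1)) ≫ (p (k + 1) ≫ i k) ≫ g' = 0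
      simp only [Category.assoc]
      rw [reassoc_of% h0 k]
      simp
  · have e : X ≃ₗ[R] (s (0 + 1)).1 := by rw [hs1]
    refine ⟨e.trans ((LinearEquiv.ofInjective (i 0).hom (hip 0).injective).trans
      (LinearEquiv.ofEq _ _ ?_))⟩
    change _ = LinearMap.range ((i 0).hom ∘ₗ (p (0 + 1)).hom)
    rw [LinearMap.range_comp, LinearMap.range_eq_top.2 (hip (0 + 1)).surjective, Submodule.map_top]

end Gorenstein

/-! ### The right module structure on Ext groups with values in the ring -/

section ExtModule

open Abelian Abelian.Ext

variable {R : Type u} [Ring R]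

/-- `Ext^n_R(X, R)` is a right `R`-module through right multiplication on `R`; for `X = A` this is
the structure of `ExtAR`. -/
instance extModule (X : ModuleCat.{u} R) (n : ℕ) :
    Module Rᵐᵒᵖ (Ext.{u} X (ModuleCat.of R R) n) where
  smul r e := e.comp (mk₀ (rightMulSelf r.unop)) (add_zero n)
  one_smul e := by
    change e.comp (mk₀ (rightMulSelf 1)) _ = _
    rw [rightMulSelf_one]; exact comp_mk₀_id _
  mul_smul r s e := by
    change e.comp (mk₀ (rightMulSelf (s.unop * r.unop))) _ = _
    rw [rightMulSelf_mul, ← mk₀_comp_mk₀]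
    exact (comp_assoc_of_third_deg_zero _ _ _ _).symm
  smul_zero r := zero_comp (X := X) (Y := ModuleCat.of R R) (n := n)
    (mk₀ (rightMulSelf r.unop)) n (add_zero n)
  smul_add r e e' := add_comp _ _ _ _
  add_smul r s e := by
    change e.comp (mk₀ (rightMulSelf (r.unop + s.unop))) _ = _
    rw [rightMulSelf_add, mk₀_add]; exact comp_add _ _ _ _
  zero_smul e := by
    change e.comp (mk₀ (rightMulSelf 0)) _ = _
    rw [rightMulSelf_zero, mk₀_zero]; exact comp_zero _ _ _ _ _

/-- Functoriality of `Ext^n_R(-, R)`. -/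
def extMap {X Y : ModuleCat.{u} R} (f : X ⟶ Y) (n : ℕ) :
    Ext.{u} Y (ModuleCat.of R R) n →ₗ[Rᵐᵒᵖ] Ext.{u} X (ModuleCat.of R R) n where
  toFun e := (mk₀ f).comp e (zero_add n)
  map_add' _ _ := comp_add _ _ _ _
  map_smul' _ _ := (comp_assoc_of_third_deg_zero _ _ _ _).symm

theorem extMap_comp {X Y Z : ModuleCat.{u} R} (f : X ⟶ Y) (g : Y ⟶ Z) (n : ℕ)
    (e : Ext.{u} Z (ModuleCat.of R R) n) : extMap (f ≫ g) n e = extMap f n (extMap g n e) :=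
  (mk₀_comp_mk₀_assoc f g e).symm

theorem extMap_id (X : ModuleCat.{u} R) (n : ℕ) : extMap (𝟙 X) n = LinearMap.id :=
  LinearMap.ext fun e => mk₀_id_comp e

theorem extMap_add {X Y : ModuleCat.{u} R} (f g : X ⟶ Y) (n : ℕ) :
    extMap (f + g) n = extMap f n + extMap g n := by
  ext e
  change (mk₀ (f + g)).comp e (zero_add n) = _
  rw [mk₀_add, add_comp]; rfl

/-- The right module `Coker (Ext^n_R(f, R))`. -/
def extCoker {X Y : ModuleCat.{u} R} (f : X ⟶ Y) (n : ℕ) : ModuleCat.{u} Rᵐᵒᵖ :=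
  ModuleCat.of Rᵐᵒᵖ (Ext.{u} X (ModuleCat.of R R) n ⧸ LinearMap.range (extMap f n))

namespace IsSES

variable {X Y Z X' Y' Z' : ModuleCat.{u} R} {i : X ⟶ Y} {p : Y ⟶ Z} {i' : X' ⟶ Y'} {p' : Y' ⟶ Z'}

/-- The connecting map `Ext^n(X, R) ⟶ Ext^{n+1}(Z, R)`. -/
def δ (h : IsSES i p) (n : ℕ) :
    Ext.{u} X (ModuleCat.of R R) n →ₗ[Rᵐᵒᵖ] Ext.{u} Z (ModuleCat.of R R) (n + 1) where
  toFun e := h.extClass.comp e (add_comm 1 n)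
  map_add' _ _ := comp_add _ _ _ _
  map_smul' _ _ := (comp_assoc_of_third_deg_zero _ _ _ _).symm

/-- The connecting map `Hom(X, R) ⟶ Ext¹(Z, R)`. -/
def δ₀ (h : IsSES i p) : (X →ₗ[R] R) →ₗ[Rᵐᵒᵖ] Ext.{u} Z (ModuleCat.of R R) 1 where
  toFun g := h.extClass.comp (mk₀ (Y := ModuleCat.of R R) (ModuleCat.ofHom g)) (add_zero 1)
  map_add' g g' := by
    rw [show ModuleCat.ofHom (Y := R) (g + g') = ModuleCat.ofHom g + ModuleCat.ofHom g' from rfl,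
      mk₀_add, comp_add]
  map_smul' r g := by
    rw [show ModuleCat.ofHom (Y := R) (r • g) = ModuleCat.ofHom g ≫ rightMulSelf r.unop from rfl,
      ← mk₀_comp_mk₀]
    exact (comp_assoc_of_third_deg_zero _ _ _ _).symm

theorem extClass_naturality (h : IsSES i p) (h' : IsSES i' p') (a : X ⟶ X') (b : Y ⟶ Y')
    (c : Z ⟶ Z') (hab : i ≫ b = a ≫ i') (hbc : p ≫ c = b ≫ p') :
    h.extClass.comp (mk₀ a) (add_zero 1) = (mk₀ c).comp h'.extClass (zero_add 1) :=
  ShortComplex.ShortExact.extClass_naturality h.shortExact h'.shortExact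
    { τ₁ := a, τ₂ := b, τ₃ := c, comm₁₂ := hab.symm, comm₂₃ := hbc.symm }

theorem δ_naturality (h : IsSES i p) (h' : IsSES i' p') (a : X ⟶ X') (b : Y ⟶ Y')
    (c : Z ⟶ Z') (hab : i ≫ b = a ≫ i') (hbc : p ≫ c = b ≫ p') (n : ℕ)
    (e : Ext.{u} X' (ModuleCat.of R R) n) :
    h.δ n (extMap a n e) = extMap c (n + 1) (h'.δ n e) := by
  change h.extClass.comp ((mk₀ a).comp e (zero_add n)) (add_comm 1 n) =
    (mk₀ c).comp (h'.extClass.comp e (add_comm 1 n)) (zero_add _)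
  rw [← comp_assoc_of_second_deg_zero, h.extClass_naturality h' a b c hab hbc,
    comp_assoc _ _ _ (zero_add 1) (add_comm 1 n) (by omega)]

theorem δ₀_naturality (h : IsSES i p) (h' : IsSES i' p') (a : X ⟶ X') (b : Y ⟶ Y')
    (c : Z ⟶ Z') (hab : i ≫ b = a ≫ i') (hbc : p ≫ c = b ≫ p') (g : X' →ₗ[R] R) :
    h.δ₀ (g ∘ₗ a.hom) = extMap c 1 (h'.δ₀ g) := by
  change h.extClass.comp (mk₀ (a ≫ ModuleCat.ofHom g)) (add_zero 1) = _
  rw [← mk₀_comp_mk₀, ← comp_assoc_of_third_deg_zero, h.extClass_naturality h' a b c hab hbc,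
    comp_assoc_of_third_deg_zero]
  rfl

theorem δ_bijective (h : IsSES i p) (hY : Module.Projective R Y) (n : ℕ) :
    Function.Bijective (h.δ (n + 1)) := by
  constructor
  · rw [injective_iff_map_eq_zero]
    intro e he
    obtain ⟨e', rfl⟩ := contravariant_sequence_exact₁ h.shortExact _ e (add_comm 1 _) he
    rw [(ext_of_projective hY _ n).elim e' 0, comp_zero]
  · intro e
    exact contravariant_sequence_exact₃ h.shortExact _ e
      ((ext_of_projective hY _ (n + 1)).elim _ _) (add_comm 1 _)

theorem δ₀_surjective (h : IsSES i p) (hY : Module.Projective R Y) :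
    Function.Surjective h.δ₀ := by
  intro e
  obtain ⟨e', rfl⟩ := contravariant_sequence_exact₃ h.shortExact _ e
      ((ext_of_projective hY _ 0).elim _ _) (add_zero 1)
  obtain ⟨g, rfl⟩ := (mk₀_bijective _ _).2 e'
  exact ⟨g.hom, rfl⟩

theorem δ₀_eq_zero_iff (h : IsSES i p) (g : X →ₗ[R] R) :
    h.δ₀ g = 0 ↔ ∃ g' : Y →ₗ[R] R, g' ∘ₗ i.hom = g := by
  constructor
  · intro hg
    obtain ⟨e, he⟩ := contravariant_sequence_exact₁ h.shortExact _ _ (add_zero 1) hg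
    obtain ⟨g', rfl⟩ := (mk₀_bijective _ _).2 e
    rw [mk₀_comp_mk₀] at he
    exact ⟨g'.hom, congrArg ModuleCat.Hom.hom ((mk₀_bijective _ _).1 he)⟩
  · rintro ⟨g', rfl⟩
    change h.extClass.comp (mk₀ (i ≫ ModuleCat.ofHom g')) (add_zero 1) = 0
    rw [← mk₀_comp_mk₀, ← comp_assoc_of_second_deg_zero,
      show h.extClass.comp (mk₀ i) (add_zero 1) = 0 from h.shortExact.extClass_comp, zero_comp]

end IsSES

end ExtModule

/-! ### The horseshoe construction for four-term exact sequences -/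

section Horseshoe

variable {R : Type u} [Ring R]

/-- `0 ⟶ L ⟶ P₁ ⟶ P₀ ⟶ M ⟶ 0` is exact. -/
structure IsFourTerm {L P₁ P₀ M : ModuleCat.{u} R} (l : L ⟶ P₁) (f : P₁ ⟶ P₀) (p : P₀ ⟶ M) :
    Prop where
  injective : Function.Injective l
  exact₁ : Function.Exact l f
  exact₀ : Function.Exact f p
  surjective : Function.Surjective p

/-- Given an exact sequence `0 ⟶ L ⟶ P₁ ⟶ P₀ ⟶ M ⟶ 0` and short exact sequences
`0 ⟶ L' ⟶ Q ⟶ L ⟶ 0` and `0 ⟶ N ⟶ F ⟶ M ⟶ 0` with `Q` and `F` projective, a map of exact sequences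
from a split exact `0 ⟶ Q ⟶ C₁ ⟶ C₀ ⟶ F ⟶ 0` of projectives onto the given one, together with
its exact kernel `0 ⟶ L' ⟶ G₁ ⟶ G₀ ⟶ N ⟶ 0`. -/
structure Horseshoe {L P₁ P₀ M Q F L' N : ModuleCat.{u} R} (l : L ⟶ P₁) (f : P₁ ⟶ P₀) (p : P₀ ⟶ M)
    (j : L' ⟶ Q) (q : Q ⟶ L) (k : N ⟶ F) (r : F ⟶ M) where
  (G₁ G₀ C₁ C₀ : ModuleCat.{u} R)
  l' : L' ⟶ G₁
  f' : G₁ ⟶ G₀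
  p' : G₀ ⟶ N
  fourTerm : IsFourTerm l' f' p'
  finite₁ : Module.Finite R C₁
  finite₀ : Module.Finite R C₀
  projective₁ : Module.Projective R C₁
  projective₀ : Module.Projective R C₀
  j₁ : G₁ ⟶ C₁
  q₁ : C₁ ⟶ P₁
  ses₁ : IsSES j₁ q₁
  j₀ : G₀ ⟶ C₀
  q₀ : C₀ ⟶ P₀
  ses₀ : IsSES j₀ q₀
  ι : Q ⟶ C₁
  s : C₁ ⟶ Q
  Φ : C₁ ⟶ C₀
  c : C₀ ⟶ F
  ι_s : ι ≫ s = 𝟙 Q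
  ι_Φ : ι ≫ Φ = 0
  factor : ∀ g : C₁ →ₗ[R] R, g ∘ₗ ι.hom = 0 → ∃ g' : C₀ →ₗ[R] R, g' ∘ₗ Φ.hom = g
  j_ι : j ≫ ι = l' ≫ j₁
  ι_q₁ : ι ≫ q₁ = q ≫ l
  j₁_Φ : j₁ ≫ Φ = f' ≫ j₀
  q₁_f : q₁ ≫ f = Φ ≫ q₀
  j₀_c : j₀ ≫ c = p' ≫ k
  q₀_p : q₀ ≫ p = c ≫ r

variable {L P₁ P₀ M Q F L' N : ModuleCat.{u} R} {l : L ⟶ P₁} {f : P₁ ⟶ P₀} {p : P₀ ⟶ M}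
    {j : L' ⟶ Q} {q : Q ⟶ L} {k : N ⟶ F} {r : F ⟶ M}

theorem IsFourTerm.nonempty_horseshoe (h : IsFourTerm l f p) (hP₁ : Module.Finite R P₁)
    (hq : IsSES j q) (hQ : Module.Finite R Q) (hQ' : Module.Projective R Q)
    (hr : IsSES k r) (hF : Module.Finite R F) (hF' : Module.Projective R F) :
    Nonempty (Horseshoe l f p j q k r) := by
  obtain ⟨E, t, hE, hE', ht⟩ := exists_free_cover P₁ hP₁
  obtain ⟨v, hv⟩ := exists_projective_lift hF' h.surjective r
  have hv' : ∀ z : F, p.hom (v.hom z) = r.hom z := fun z => congrArg (fun k : F ⟶ M => k z) hv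
  have hpf : ∀ x, p.hom (f.hom x) = 0 := fun x => (h.exact₀ _).2 ⟨x, rfl⟩
  have hfl : ∀ x, f.hom (l.hom x) = 0 := fun x => (h.exact₁ _).2 ⟨x, rfl⟩
  have hrk : ∀ x, r.hom (k.hom x) = 0 := fun x => (hr.exact _).2 ⟨x, rfl⟩
  have hqj : ∀ x, q.hom (j.hom x) = 0 := fun x => (hq.exact _).2 ⟨x, rfl⟩
  -- `P₁` is covered by `(a, y) ↦ l (q a) + t y` and `P₀` by `(y, z) ↦ f (t y) + v z`, compatibly with
  -- `(a, y) ↦ (y, 0)`. The second map is onto because `v` lifts the surjection `r` onto `M`.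
  let q₁ : (Q × E) →ₗ[R] P₁ := (l.hom ∘ₗ q.hom).coprod t.hom
  let q₀ : (E × F) →ₗ[R] P₀ := (f.hom ∘ₗ t.hom).coprod v.hom
  have hq₁ : Function.Surjective q₁ := fun x => by
    obtain ⟨y, rfl⟩ := ht x
    exact ⟨(0, y), by simp [q₁]⟩
  have hq₀ : Function.Surjective q₀ := fun x => by
    obtain ⟨z, hz⟩ := hr.surjective (p x)
    obtain ⟨y, hy⟩ := (h.exact₀ (x - v z)).1 (by
      change p.hom (x - v.hom z) = 0
      rw [map_sub, hv', sub_eq_zero]; exact hz.symm)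
    obtain ⟨w, rfl⟩ := ht y
    exact ⟨(w, z), by
      change f.hom (t.hom w) + v.hom z = x
      rw [show f.hom (t.hom w) = x - v.hom z from hy, sub_add_cancel]⟩
  let Φ : (Q × E) →ₗ[R] (E × F) := (LinearMap.inl R E F) ∘ₗ LinearMap.snd R Q E
  have hΦ : ∀ x : Q × E, q₀ (Φ x) = f.hom (q₁ x) := fun x => by
    change f.hom (t.hom x.2) + v.hom 0 = f.hom (l.hom (q.hom x.1) + t.hom x.2)
    rw [map_zero, map_add, hfl, add_zero, zero_add]
  let f' : LinearMap.ker q₁ →ₗ[R] LinearMap.ker q₀ := Φ.restrict fun x hx => by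
    change q₀ (Φ x) = 0
    rw [hΦ, show q₁ x = 0 from hx, map_zero]
  obtain ⟨p', hp'⟩ := exists_ker_lift hr.exact hr.injective
    (ModuleCat.ofHom (LinearMap.snd R E F ∘ₗ (LinearMap.ker q₀).subtype)) (by
      ext ⟨⟨y, z⟩, hx⟩
      have hx : f.hom (t.hom y) + v.hom z = 0 := hx
      have := congrArg p.hom hx
      rw [map_add, hpf, zero_add, hv', map_zero] at this
      exact this)
  have hp'' : ∀ x : LinearMap.ker q₀, k.hom (p'.hom x) = x.1.2 := fun x =>
    congrArg (fun g : _ ⟶ F => g x) hp'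
  let l' : L' →ₗ[R] LinearMap.ker q₁ := (LinearMap.inl R Q E ∘ₗ j.hom).codRestrict _ fun x => by
    change l.hom (q.hom (j.hom x)) + t.hom 0 = 0
    rw [hqj, map_zero, map_zero, add_zero]
  exact ⟨{
    G₁ := ModuleCat.of R (LinearMap.ker q₁)
    G₀ := ModuleCat.of R (LinearMap.ker q₀)
    C₁ := ModuleCat.of R (Q × E)
    C₀ := ModuleCat.of R (E × F)
    l' := ModuleCat.ofHom l'
    f' := ModuleCat.ofHom f'
    p' := p'
    fourTerm := by
      refine ⟨fun x y hxy => hq.injective (congrArg (fun w : LinearMap.ker q₁ => w.1.1) hxy),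
        fun x => ⟨fun hx => ?_, ?_⟩, fun x => ⟨fun hx => ?_, ?_⟩, fun n => ?_⟩
      · obtain ⟨⟨a, b⟩, hab⟩ := x
        have hb : b = 0 := congrArg (fun w : LinearMap.ker q₀ => w.1.1) hx
        subst hb
        have hab : l.hom (q.hom a) + t.hom 0 = 0 := hab
        rw [map_zero, add_zero] at hab
        obtain ⟨a', rfl⟩ := (hq.exact a).1 (h.injective (hab.trans (map_zero l.hom).symm))
        exact ⟨a', rfl⟩
      · rintro ⟨x, rfl⟩
        rfl
      · obtain ⟨⟨y, z⟩, hyz⟩ := x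
        have hz : z = 0 := by
          have := hp'' ⟨⟨y, z⟩, hyz⟩
          rw [show p'.hom ⟨⟨y, z⟩, hyz⟩ = 0 from hx, map_zero] at this
          exact this.symm
        subst hz
        have hy : f.hom (t.hom y) + v.hom 0 = 0 := hyz
        rw [map_zero, add_zero] at hy
        obtain ⟨m, hm⟩ := (h.exact₁ (t.hom y)).1 hy
        obtain ⟨a, rfl⟩ := hq.surjective m
        refine ⟨⟨(-a, y), ?_⟩, rfl⟩
        change l.hom (q.hom (-a)) + t.hom y = 0
        rw [map_neg, map_neg, show l.hom (q.hom a) = t.hom y from hm, neg_add_cancel]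
      · rintro ⟨x, rfl⟩
        exact hr.injective ((hp'' _).trans (map_zero k.hom).symm)
      · obtain ⟨b, hb⟩ := (h.exact₀ (v.hom (k.hom n))).1 ((hv' _).trans (hrk n))
        obtain ⟨y, rfl⟩ := ht b
        refine ⟨⟨(-y, k.hom n), ?_⟩, hr.injective (hp'' _)⟩
        change f.hom (t.hom (-y)) + v.hom (k.hom n) = 0
        rw [map_neg, map_neg, show f.hom (t.hom y) = _ from hb, neg_add_cancel]
    finite₁ := inferInstanceAs (Module.Finite R (Q × E))
    finite₀ := inferInstanceAs (Module.Finite R (E × F))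
    projective₁ := inferInstanceAs (Module.Projective R (Q × E))
    projective₀ := inferInstanceAs (Module.Projective R (E × F))
    j₁ := ModuleCat.ofHom (LinearMap.ker q₁).subtype
    q₁ := ModuleCat.ofHom q₁
    ses₁ := isSES_ker (ModuleCat.ofHom q₁) hq₁
    j₀ := ModuleCat.ofHom (LinearMap.ker q₀).subtype
    q₀ := ModuleCat.ofHom q₀
    ses₀ := isSES_ker (ModuleCat.ofHom q₀) hq₀
    ι := ModuleCat.ofHom (LinearMap.inl R Q E)
    s := ModuleCat.ofHom (LinearMap.fst R Q E)
    Φ := ModuleCat.ofHom Φ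
    c := ModuleCat.ofHom (LinearMap.snd R E F)
    ι_s := rfl
    ι_Φ := ModuleCat.hom_ext (LinearMap.ext fun _ => rfl)
    factor := fun g hg => ⟨g ∘ₗ LinearMap.inr R Q E ∘ₗ LinearMap.fst R E F, by
      ext x
      · exact (map_zero g).trans (LinearMap.congr_fun hg x).symm
      · rfl⟩
    j_ι := rfl
    ι_q₁ := by
      ext x
      change l.hom (q.hom x) + t.hom 0 = _
      rw [map_zero, add_zero]; rfl
    j₁_Φ := rfl
    q₁_f := ModuleCat.hom_ext (LinearMap.ext fun x => (hΦ x).symm)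
    j₀_c := hp'.symm
    q₀_p := by
      refine ModuleCat.hom_ext (LinearMap.ext fun x => ?_)
      change p.hom (f.hom (t.hom x.1) + v.hom x.2) = r.hom x.2
      rw [map_add, hpf, zero_add, hv'] }⟩

namespace Horseshoe

variable (H : Horseshoe l f p j q k r)

/-- The connecting maps `Hom(G₁, R) ⟶ Ext¹(P₁, R)` and `Hom(G₀, R) ⟶ Ext¹(P₀, R)` induce a
surjection from `Coker Hom(f', R)` to `Coker Ext¹(f, R)`. The snake lemma identifies its kernel
with a quotient of `Hom(Q, R)`. The hypothesis on `f` and `p` makes `Hom(N, R)` surject onto the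
kernel of `Ext¹(f, R)`, and so determines the kernel of `Hom(Q, R) ⟶ Coker Hom(f', R)`. -/
theorem exists_exact_dualCoker (hr : IsSES k r) (hF : Module.Projective R F)
    (hΦ : ∀ e, extMap f 1 e = 0 → ∃ e', e = extMap p 1 e') :
    ∃ (i : ModuleCat.of Rᵐᵒᵖ (Q →ₗ[R] R) ⟶ dualCoker H.f') (π : dualCoker H.f' ⟶ extCoker f 1),
      Function.Exact i π ∧ Function.Surjective π ∧
      ∀ a : Q →ₗ[R] R, i a = 0 ↔ ∃ h : P₁ →ₗ[R] R, h ∘ₗ l.hom ∘ₗ q.hom = a := by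
  have hδ : ∀ g : H.G₀ →ₗ[R] R, H.ses₁.δ₀ (g ∘ₗ H.f'.hom) = extMap f 1 (H.ses₀.δ₀ g) :=
    H.ses₁.δ₀_naturality H.ses₀ H.f' H.Φ f H.j₁_Φ H.q₁_f
  have hδN : ∀ g : N →ₗ[R] R, H.ses₀.δ₀ (g ∘ₗ H.p'.hom) = extMap p 1 (hr.δ₀ g) :=
    H.ses₀.δ₀_naturality hr H.p' H.c p H.j₀_c H.q₀_p
  have hsι : H.s.hom ∘ₗ H.ι.hom = LinearMap.id := congrArg ModuleCat.Hom.hom H.ι_s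
  have hΦι : H.Φ.hom ∘ₗ H.ι.hom = 0 := congrArg ModuleCat.Hom.hom H.ι_Φ
  have hΦj : H.Φ.hom ∘ₗ H.j₁.hom = H.j₀.hom ∘ₗ H.f'.hom := congrArg ModuleCat.Hom.hom H.j₁_Φ
  have hqι : H.q₁.hom ∘ₗ H.ι.hom = l.hom ∘ₗ q.hom := congrArg ModuleCat.Hom.hom H.ι_q₁
  have hqj : H.q₁.hom ∘ₗ H.j₁.hom = 0 :=
    congrArg ModuleCat.Hom.hom (comp_eq_zero_of_exact H.ses₁.exact)
  let i : (Q →ₗ[R] R) →ₗ[Rᵐᵒᵖ] _ ⧸ LinearMap.range (dualMap H.f') :=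
    (LinearMap.range (dualMap H.f')).mkQ ∘ₗ dualMap (H.j₁ ≫ H.s)
  let π : (_ ⧸ LinearMap.range (dualMap H.f')) →ₗ[Rᵐᵒᵖ] _ ⧸ LinearMap.range (extMap f 1) :=
    Submodule.mapQ _ _ H.ses₁.δ₀ (by
      rintro _ ⟨g, rfl⟩
      exact ⟨_, (hδ g).symm⟩)
  -- A functional on `C₁` agrees on `G₁`, up to the image of `Hom(G₀, R)`, with the pullback of its
  -- restriction to `Q`.
  have hmod : ∀ g : H.C₁ →ₗ[R] R,
      g ∘ₗ H.j₁.hom - (g ∘ₗ H.ι.hom) ∘ₗ H.s.hom ∘ₗ H.j₁.hom ∈ LinearMap.range (dualMap H.f') := by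
    intro g
    obtain ⟨g', hg'⟩ := H.factor (g - (g ∘ₗ H.ι.hom) ∘ₗ H.s.hom) (by
      rw [LinearMap.sub_comp, LinearMap.comp_assoc _ _ (g ∘ₗ H.ι.hom), hsι, LinearMap.comp_id, sub_self])
    refine ⟨g' ∘ₗ H.j₀.hom, ?_⟩
    change (g' ∘ₗ H.j₀.hom) ∘ₗ H.f'.hom = _
    rw [LinearMap.comp_assoc, ← hΦj, ← LinearMap.comp_assoc, hg', LinearMap.sub_comp]
    rfl
  refine ⟨ModuleCat.ofHom i, ModuleCat.ofHom π, fun x => ?_, fun x => ?_, fun a => ?_⟩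
  · obtain ⟨g, rfl⟩ := Submodule.mkQ_surjective _ x
    change Submodule.Quotient.mk (H.ses₁.δ₀ g) = 0 ↔ _
    rw [Submodule.Quotient.mk_eq_zero]
    constructor
    · rintro ⟨e, he⟩
      obtain ⟨g₀, rfl⟩ := H.ses₀.δ₀_surjective H.projective₀ e
      obtain ⟨g', hg'⟩ := (H.ses₁.δ₀_eq_zero_iff (g - g₀ ∘ₗ H.f'.hom)).1 (by
        rw [map_sub, hδ, he, sub_self])
      refine ⟨g' ∘ₗ H.ι.hom, ?_⟩
      change Submodule.Quotient.mk _ = Submodule.Quotient.mk g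
      rw [eq_comm, Submodule.Quotient.eq]
      have h1 := hmod g'
      rw [hg'] at h1
      have h2 := add_mem h1 (LinearMap.mem_range_self (dualMap H.f') g₀)
      convert h2 using 1
      change _ = _ + g₀ ∘ₗ H.f'.hom
      rw [sub_add_eq_add_sub, sub_add_cancel]
      rfl
    · rintro ⟨a, ha⟩
      have ha : Submodule.Quotient.mk (dualMap (H.j₁ ≫ H.s) a) = Submodule.Quotient.mk g := ha
      rw [eq_comm, Submodule.Quotient.eq] at ha
      obtain ⟨g₀, hg₀⟩ := ha
      refine ⟨H.ses₀.δ₀ g₀, ?_⟩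
      have h0 : H.ses₁.δ₀ (dualMap (H.j₁ ≫ H.s) a) = 0 :=
        (H.ses₁.δ₀_eq_zero_iff _).2 ⟨a ∘ₗ H.s.hom, rfl⟩
      rw [← hδ, ← sub_eq_zero, show g₀ ∘ₗ H.f'.hom = _ from hg₀, map_sub, h0, sub_zero, sub_self]
  · obtain ⟨e, rfl⟩ := Submodule.mkQ_surjective _ x
    obtain ⟨g, rfl⟩ := H.ses₁.δ₀_surjective H.projective₁ e
    exact ⟨Submodule.Quotient.mk g, rfl⟩
  · change Submodule.Quotient.mk (dualMap (H.j₁ ≫ H.s) a) = 0 ↔ _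
    rw [Submodule.Quotient.mk_eq_zero]
    constructor
    · rintro ⟨g, hg⟩
      have hg : g ∘ₗ H.f'.hom = a ∘ₗ H.s.hom ∘ₗ H.j₁.hom := hg
      obtain ⟨e, he⟩ := hΦ (H.ses₀.δ₀ g) (by
        rw [← hδ, hg]
        exact (H.ses₁.δ₀_eq_zero_iff _).2 ⟨a ∘ₗ H.s.hom, rfl⟩)
      obtain ⟨ν, rfl⟩ := hr.δ₀_surjective hF e
      obtain ⟨g', hg'⟩ := (H.ses₀.δ₀_eq_zero_iff (g - ν ∘ₗ H.p'.hom)).1 (by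
        rw [map_sub, he, hδN, sub_self])
      have hp'f' : H.p'.hom ∘ₗ H.f'.hom = 0 :=
        congrArg ModuleCat.Hom.hom (comp_eq_zero_of_exact H.fourTerm.exact₀)
      have hzero : H.j₁ ≫ (ModuleCat.ofHom (a ∘ₗ H.s.hom - g' ∘ₗ H.Φ.hom) :
          H.C₁ ⟶ ModuleCat.of R R) = 0 := by
        apply ModuleCat.hom_ext
        change (a ∘ₗ H.s.hom - g' ∘ₗ H.Φ.hom) ∘ₗ H.j₁.hom = 0
        rw [LinearMap.sub_comp, LinearMap.comp_assoc _ _ g', hΦj, ← LinearMap.comp_assoc _ _ g', hg',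
          LinearMap.sub_comp, LinearMap.comp_assoc _ _ ν, hp'f', LinearMap.comp_zero, sub_zero, hg]
        exact sub_self _
      obtain ⟨h, hh⟩ := exists_desc H.ses₁.exact H.ses₁.surjective _ hzero
      refine ⟨h.hom, ?_⟩
      have hh : h.hom ∘ₗ H.q₁.hom = a ∘ₗ H.s.hom - g' ∘ₗ H.Φ.hom :=
        congrArg ModuleCat.Hom.hom hh
      rw [← hqι, ← LinearMap.comp_assoc, hh, LinearMap.sub_comp, LinearMap.comp_assoc,
        LinearMap.comp_assoc, hsι, hΦι, LinearMap.comp_zero, sub_zero, LinearMap.comp_id]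
    · rintro ⟨h, rfl⟩
      have h1 := hmod (h ∘ₗ H.q₁.hom)
      rw [LinearMap.comp_assoc, LinearMap.comp_assoc _ _ h, hqj, hqι, LinearMap.comp_zero, zero_sub,
        neg_mem_iff] at h1
      exact h1

end Horseshoe

end Horseshoe

/-! ### Gorenstein transposes of syzygies -/

section Syzygies

open Abelian

variable {R : Type u} [Ring R]

namespace Horseshoe

variable {L P₁ P₀ M Q F L' N : ModuleCat.{u} R} {l : L ⟶ P₁} {f : P₁ ⟶ P₀} {p : P₀ ⟶ M}
    {j : L' ⟶ Q} {q : Q ⟶ L} {k : N ⟶ F} {r : F ⟶ M} (H : Horseshoe l f p j q k r)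

/-- The condition that the kernel of `Ext^b(f, R)` comes from `Ext^b(M, R)` passes down to degree
`a = b - 1` in the kernel row. -/
theorem exists_of_extMap_eq_zero (hr : IsSES k r) (hF : Module.Projective R F) {a b : ℕ}
    (ha : a ≠ 0) (hb : a + 1 = b) (hΦ : ∀ e, extMap f b e = 0 → ∃ e', e = extMap p b e') :
    ∀ e, extMap H.f' a e = 0 → ∃ e', e = extMap H.p' a e' := by
  obtain ⟨n, rfl⟩ := Nat.exists_eq_succ_of_ne_zero ha
  subst hb
  intro e he
  obtain ⟨e', he'⟩ := hΦ (H.ses₀.δ (n + 1) e) (by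
    rw [← H.ses₁.δ_naturality H.ses₀ H.f' H.Φ f H.j₁_Φ H.q₁_f (n + 1), he, map_zero])
  obtain ⟨e₁, rfl⟩ := (hr.δ_bijective hF n).2 e'
  refine ⟨e₁, (H.ses₀.δ_bijective H.projective₀ n).1 ?_⟩
  rw [he', H.ses₀.δ_naturality hr H.p' H.c p H.j₀_c H.q₀_p (n + 1)]

theorem nonempty_extCoker_equiv {a b : ℕ} (ha : a ≠ 0) (hb : a + 1 = b) :
    Nonempty (extCoker H.f' a ≃ₗ[Rᵐᵒᵖ] extCoker f b) := by
  obtain ⟨n, rfl⟩ := Nat.exists_eq_succ_of_ne_zero ha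
  subst hb
  have hnat := H.ses₁.δ_naturality H.ses₀ H.f' H.Φ f H.j₁_Φ H.q₁_f (n + 1)
  refine ⟨Submodule.Quotient.equiv _ _
    (LinearEquiv.ofBijective _ (H.ses₁.δ_bijective H.projective₁ n)) ?_⟩
  ext x
  constructor
  · rintro ⟨_, ⟨e, rfl⟩, rfl⟩
    exact ⟨_, (hnat e).symm⟩
  · rintro ⟨e, rfl⟩
    obtain ⟨e, rfl⟩ := (H.ses₀.δ_bijective H.projective₀ n).2 e
    exact ⟨_, ⟨e, rfl⟩, hnat e⟩

theorem ext_G₁ (n : ℕ) (h : ∀ m, n + 1 < m → Subsingleton (Ext.{u} P₁ (ModuleCat.of R R) m)) :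
    ∀ m, n < m → Subsingleton (Ext.{u} H.G₁ (ModuleCat.of R R) m) := by
  intro m hm
  obtain ⟨m, rfl⟩ := Nat.exists_eq_succ_of_ne_zero (show m ≠ 0 by omega)
  exact H.ses₁.ext_left _ (ext_of_projective H.projective₁ _ m) (h _ (by omega))

theorem ext_G₀ (n : ℕ) (h : ∀ m, n + 1 < m → Subsingleton (Ext.{u} P₀ (ModuleCat.of R R) m)) :
    ∀ m, n < m → Subsingleton (Ext.{u} H.G₀ (ModuleCat.of R R) m) := by
  intro m hm
  obtain ⟨m, rfl⟩ := Nat.exists_eq_succ_of_ne_zero (show m ≠ 0 by omega)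
  exact H.ses₀.ext_left _ (ext_of_projective H.projective₀ _ m) (h _ (by omega))

theorem vanishAbove_G₁ {d : ℕ} (h : VanishAbove d P₁) : VanishAbove d H.G₁ :=
  VanishAbove.left H.ses₁ ((VanishAbove.of_projective H.projective₁).mono (Nat.zero_le d)) h

theorem vanishAbove_G₀ {d : ℕ} (h : VanishAbove d P₀) : VanishAbove d H.G₀ :=
  VanishAbove.left H.ses₀ ((VanishAbove.of_projective H.projective₀).mono (Nat.zero_le d)) h

variable [IsNoetherianRing R]

theorem finite_G₁ : Module.Finite R H.G₁ := finite_of_injective _ H.ses₁.injective H.finite₁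

theorem finite_G₀ : Module.Finite R H.G₀ := finite_of_injective _ H.ses₀.injective H.finite₀

theorem isGorensteinTranspose [IsNoetherianRing Rᵐᵒᵖ] {d : ℕ}
    (h₁ : ∀ m, 1 < m → Subsingleton (Ext.{u} P₁ (ModuleCat.of R R) m)) (hv₁ : VanishAbove d P₁)
    (h₀ : ∀ m, 1 < m → Subsingleton (Ext.{u} P₀ (ModuleCat.of R R) m)) (hv₀ : VanishAbove d P₀) :
    IsGorensteinTranspose N (dualCoker H.f') := by
  refine ⟨_, _, H.f', H.p', ⟨H.finite_G₁, ?_, H.finite_G₀, ?_, H.fourTerm.exact₀,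
    H.fourTerm.surjective⟩, ⟨Iso.refl _⟩⟩
  · exact HasGorensteinVanishing.isGorensteinProjective
      ⟨H.finite_G₁, fun m => H.ext_G₁ 0 h₁ _ m.succ_pos, d, H.vanishAbove_G₁ hv₁⟩
  · exact HasGorensteinVanishing.isGorensteinProjective
      ⟨H.finite_G₀, fun m => H.ext_G₀ 0 h₀ _ m.succ_pos, d, H.vanishAbove_G₀ hv₀⟩

end Horseshoe

theorem IsSyzygy.exists_isSES {M N : ModuleCat.{u} R} (h : IsSyzygy 1 M N) :
    ∃ (F : ModuleCat.{u} R) (k : N ⟶ F) (r : F ⟶ M), Module.Finite R F ∧ Module.Projective R F ∧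
      IsSES k r := by
  cases h with
  | succ _ _ M' P _ i p hP hP' hi hex hs h =>
    cases h with
    | zero _ _ e =>
      refine ⟨P, e.inv ≫ i, p, hP, hP', ?_, fun y => ?_, hs⟩
      · exact hi.comp e.symm.toLinearEquiv.injective
      · rw [hex y]
        constructor
        · rintro ⟨x, rfl⟩
          exact ⟨e.hom x, congrArg i (e.toLinearEquiv.symm_apply_apply x)⟩
        · rintro ⟨x, rfl⟩
          exact ⟨_, rfl⟩

theorem ExistsShortExact.of_equiv {S : Type u} [Ring S] {X Y Z Z' : ModuleCat.{u} S}
    (h : ExistsShortExact X Y Z) (e : Z ≃ₗ[S] Z') : ExistsShortExact X Y Z' := by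
  obtain ⟨i, q, hi, hex, hq⟩ := h
  refine ⟨i, ModuleCat.ofHom (e.toLinearMap ∘ₗ q.hom), hi, fun y => ?_, e.surjective.comp hq⟩
  change e (q y) = 0 ↔ _
  rw [e.map_eq_zero_iff, hex y]

theorem existsShortExact_dualCoker {Q₁ Q₀ : ModuleCat.{u} R} {Y Z : ModuleCat.{u} Rᵐᵒᵖ}
    (g : Q₁ ⟶ Q₀) (i : ModuleCat.of Rᵐᵒᵖ (Q₁ →ₗ[R] R) ⟶ Y) (q : Y ⟶ Z)
    (hex : Function.Exact i q) (hq : Function.Surjective q)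
    (hg : ∀ x : Q₁ →ₗ[R] R, i x = 0 ↔ x ∈ LinearMap.range (dualMap g)) :
    ExistsShortExact (dualCoker g) Y Z := by
  let i' : (Q₁ →ₗ[R] R) →ₗ[Rᵐᵒᵖ] Y := i.hom
  have hk : LinearMap.range (dualMap g) ≤ LinearMap.ker i' := fun x hx => (hg x).2 hx
  refine ⟨ModuleCat.ofHom ((LinearMap.range (dualMap g)).liftQ i' hk), q, ?_, fun y => ?_, hq⟩
  · rw [injective_iff_map_eq_zero]
    intro x hx
    obtain ⟨x, rfl⟩ := Submodule.mkQ_surjective _ x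
    exact (Submodule.Quotient.mk_eq_zero _).2 ((hg x).1 hx)
  · rw [hex y]
    constructor
    · rintro ⟨x, rfl⟩
      exact ⟨Submodule.Quotient.mk x, rfl⟩
    · rintro ⟨x, rfl⟩
      obtain ⟨x, rfl⟩ := Submodule.mkQ_surjective _ x
      exact ⟨x, rfl⟩

section

variable [IsNoetherianRing R] [IsNoetherianRing Rᵐᵒᵖ]

/-- The case of a first syzygy, where `Hom(P₁, R) = 0` makes `Hom(Q, R)` embed into the Gorenstein
transpose. -/
theorem IsFourTerm.exists_gorensteinTranspose_of_one {L P₁ P₀ M N : ModuleCat.{u} R} {l : L ⟶ P₁}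
    {f : P₁ ⟶ P₀} {p : P₀ ⟶ M} (h : IsFourTerm l f p) (hP₁ : Module.Finite R P₁) {d : ℕ}
    (h₁ : ∀ m, 1 < m → Subsingleton (Ext.{u} P₁ (ModuleCat.of R R) m)) (hv₁ : VanishAbove d P₁)
    (h₀ : ∀ m, 1 < m → Subsingleton (Ext.{u} P₀ (ModuleCat.of R R) m)) (hv₀ : VanishAbove d P₀)
    (hΦ : ∀ e, extMap f 1 e = 0 → ∃ e', e = extMap p 1 e')
    (hd : Subsingleton (P₁ →ₗ[R] R)) (hN : IsSyzygy 1 M N) :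
    ∃ (Q : ModuleCat.{u} R) (T : ModuleCat.{u} Rᵐᵒᵖ), Module.Finite R Q ∧ Module.Projective R Q ∧
      IsGorensteinTranspose N T ∧
      ExistsShortExact (ModuleCat.of Rᵐᵒᵖ (Q →ₗ[R] R)) T (extCoker f 1) := by
  obtain ⟨F, k, r, hF, hF', hr⟩ := hN.exists_isSES
  obtain ⟨Q, q, hQ, hQ', hq⟩ := exists_free_cover L (finite_of_injective _ h.injective hP₁)
  obtain ⟨H⟩ := h.nonempty_horseshoe hP₁ (isSES_ker q hq) hQ hQ' hr hF hF'
  obtain ⟨i, π, hex, hπ, hi⟩ := H.exists_exact_dualCoker hr hF' hΦ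
  refine ⟨Q, _, hQ, hQ', H.isGorensteinTranspose h₁ hv₁ h₀ hv₀, i, π, ?_, hex, hπ⟩
  change Function.Injective i.hom
  rw [injective_iff_map_eq_zero]
  intro a ha
  obtain ⟨g, rfl⟩ := (hi a).1 ha
  rw [Subsingleton.elim g 0]
  rfl

/-- The case of a second syzygy. Two horseshoes are stacked, with `Q₁ ⟶ Q₀ ⟶ L` as their left
columns, so that the functionals on `Q₁` killed in the Gorenstein transpose are those coming from
`Q₀`. -/
theorem IsFourTerm.exists_gorensteinTranspose_of_two {L P₁ P₀ M N L' Q₁ Q₀ : ModuleCat.{u} R}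
    {l : L ⟶ P₁} {f : P₁ ⟶ P₀} {p : P₀ ⟶ M} (h : IsFourTerm l f p) (hP₁ : Module.Finite R P₁)
    {d : ℕ}
    (h₁ : ∀ m, 2 < m → Subsingleton (Ext.{u} P₁ (ModuleCat.of R R) m)) (hv₁ : VanishAbove d P₁)
    (h₀ : ∀ m, 2 < m → Subsingleton (Ext.{u} P₀ (ModuleCat.of R R) m)) (hv₀ : VanishAbove d P₀)
    (hΦ : ∀ e, extMap f 2 e = 0 → ∃ e', e = extMap p 2 e')
    (hL : Subsingleton (Ext.{u} L (ModuleCat.of R R) 1))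
    (hN : IsSyzygy 2 M N) (hL' : IsSyzygy 0 L L') {g : Q₁ ⟶ Q₀} {t : Q₀ ⟶ L'}
    (hg : IsProjPresentation g t) :
    ∃ T : ModuleCat.{u} Rᵐᵒᵖ, IsGorensteinTranspose N T ∧
      ExistsShortExact (dualCoker g) T (extCoker f 2) := by
  obtain ⟨e⟩ : Nonempty (L ≅ L') := by cases hL' with | zero _ _ e => exact ⟨e⟩
  cases hN with
  | succ _ _ M' F _ k r hF hF' hk hkr hr hN =>
  obtain ⟨F', k', r', hF₂, hF₂', hr'⟩ := hN.exists_isSES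
  have hQ₀ := hg.projective₀
  have hQ₁ := hg.projective₁
  have hts : Function.Surjective (t ≫ e.inv) :=
    e.symm.toLinearEquiv.surjective.comp hg.surjective
  have hj := isSES_ker (t ≫ e.inv) hts
  obtain ⟨H⟩ := h.nonempty_horseshoe hP₁ hj hg.finite₀ hQ₀ ⟨hk, hkr, hr⟩ hF hF'
  obtain ⟨q, hq⟩ := exists_ker_lift hj.exact hj.injective g (by
    rw [← Category.assoc, comp_eq_zero_of_exact hg.exact, Limits.zero_comp])
  have hqs : Function.Surjective q := by
    rintro ⟨y, hy⟩
    have hy : e.symm.toLinearEquiv (t.hom y) = 0 := hy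
    rw [LinearEquiv.map_eq_zero_iff] at hy
    obtain ⟨x, rfl⟩ := (hg.exact y).1 hy
    exact ⟨x, Subtype.ext (congrArg (fun k : Q₁ ⟶ Q₀ => k x) hq)⟩
  obtain ⟨H'⟩ := H.fourTerm.nonempty_horseshoe H.finite_G₁ (isSES_ker q hqs) hg.finite₁ hQ₁ hr'
    hF₂ hF₂'
  obtain ⟨i, π, hex, hπ, hi⟩ := H'.exists_exact_dualCoker hr' hF₂'
    (H.exists_of_extMap_eq_zero ⟨hk, hkr, hr⟩ hF' one_ne_zero rfl hΦ)
  obtain ⟨ec⟩ := H.nonempty_extCoker_equiv (a := 1) (b := 2) one_ne_zero rfl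
  refine ⟨_, H'.isGorensteinTranspose (H.ext_G₁ 1 h₁) (H.vanishAbove_G₁ hv₁) (H.ext_G₀ 1 h₀)
    (H.vanishAbove_G₀ hv₀), ExistsShortExact.of_equiv (Z := extCoker H.f' 1) ?_ ec⟩
  refine existsShortExact_dualCoker g i π hex hπ fun a => ?_
  have hqg : ∀ b : Q₀ →ₗ[R] R,
      (b ∘ₗ (LinearMap.ker (t ≫ e.inv).hom).subtype) ∘ₗ q.hom = dualMap g b := fun b => by
    rw [← hq]; rfl
  rw [hi a]
  constructor
  · rintro ⟨b, rfl⟩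
    -- `Ext¹(L, R) = 0`, so functionals on the kernel of `Q₀ ⟶ L` extend to `Q₀`.
    obtain ⟨c, hc⟩ := hj.exists_extension hL (ModuleCat.ofHom (b ∘ₗ H.l'.hom))
    refine ⟨c.hom, ?_⟩
    rw [← hqg]
    have := congrArg ModuleCat.Hom.hom hc
    exact congrArg (fun w => w ∘ₗ q.hom) this
  · rintro ⟨b, rfl⟩
    refine ⟨b ∘ₗ H.s.hom ∘ₗ H.j₁.hom, ?_⟩
    have h2 : H.l' ≫ H.j₁ ≫ H.s =
        ModuleCat.ofHom (LinearMap.ker (t ≫ e.inv).hom).subtype := by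
      rw [← Category.assoc, ← H.j_ι, Category.assoc, H.ι_s, Category.comp_id]
    rw [← hqg]
    exact congrArg (fun w => b ∘ₗ w ∘ₗ q.hom) (congrArg ModuleCat.Hom.hom h2)

/-- Each further syzygy is taken by one more horseshoe, which lowers the degree of all Ext
conditions by one and preserves the cokernel of the map induced by `f`. -/
theorem IsFourTerm.exists_gorensteinTranspose (n : ℕ) {L P₁ P₀ M N L' Q₁ Q₀ : ModuleCat.{u} R}
    {l : L ⟶ P₁} {f : P₁ ⟶ P₀} {p : P₀ ⟶ M} (h : IsFourTerm l f p) (hP₁ : Module.Finite R P₁)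
    {d : ℕ}
    (h₁ : ∀ m, n + 2 < m → Subsingleton (Ext.{u} P₁ (ModuleCat.of R R) m))
    (hv₁ : VanishAbove d P₁)
    (h₀ : ∀ m, n + 2 < m → Subsingleton (Ext.{u} P₀ (ModuleCat.of R R) m))
    (hv₀ : VanishAbove d P₀)
    (hΦ : ∀ e, extMap f (n + 2) e = 0 → ∃ e', e = extMap p (n + 2) e')
    (hL : Subsingleton (Ext.{u} L (ModuleCat.of R R) (n + 1)))
    (hN : IsSyzygy (n + 2) M N) (hL' : IsSyzygy n L L') {g : Q₁ ⟶ Q₀} {t : Q₀ ⟶ L'}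
    (hg : IsProjPresentation g t) :
    ∃ T : ModuleCat.{u} Rᵐᵒᵖ, IsGorensteinTranspose N T ∧
      ExistsShortExact (dualCoker g) T (extCoker f (n + 2)) := by
  induction n generalizing L P₁ P₀ M with
  | zero =>
    exact h.exists_gorensteinTranspose_of_two hP₁ h₁ hv₁ h₀ hv₀ hΦ hL hN hL' hg
  | succ n ih =>
    cases hN with
    | succ _ _ M' F _ k r hF hF' hk hkr hr hN =>
    cases hL' with
    | succ _ _ L₁ Q _ j q hQ hQ' hj hjq hq hL' =>
    obtain ⟨H⟩ := h.nonempty_horseshoe hP₁ ⟨hj, hjq, hq⟩ hQ hQ' ⟨hk, hkr, hr⟩ hF hF'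
    obtain ⟨ec⟩ := H.nonempty_extCoker_equiv (n + 1).succ_ne_zero rfl
    obtain ⟨T, hT, hs⟩ := ih H.fourTerm H.finite_G₁ (H.ext_G₁ (n + 2) h₁) (H.vanishAbove_G₁ hv₁)
      (H.ext_G₀ (n + 2) h₀) (H.vanishAbove_G₀ hv₀)
      (H.exists_of_extMap_eq_zero ⟨hk, hkr, hr⟩ hF' (n + 1).succ_ne_zero rfl hΦ)
      (IsSES.ext_left ⟨hj, hjq, hq⟩ _ (ext_of_projective hQ' _ n) hL) hN hL'
    exact ⟨T, hT, hs.of_equiv ec⟩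

end

/-! ### Projective dimension of transposes of syzygies -/

theorem projective_dual (X : ModuleCat.{u} R) (hX : Module.Finite R X)
    (hX' : Module.Projective R X) : Module.Projective Rᵐᵒᵖ (X →ₗ[R] R) := by
  obtain ⟨n, f, hf⟩ := Module.Finite.exists_fin' R X
  obtain ⟨s, hs⟩ := Module.projective_lifting_property f LinearMap.id hf
  let e : Rᵐᵒᵖ ≃ₗ[Rᵐᵒᵖ] R :=
    { toFun := MulOpposite.unop, invFun := MulOpposite.op, map_add' := fun _ _ => rfl,
      map_smul' := fun _ _ => rfl, left_inv := fun _ => rfl, right_inv := fun _ => rfl }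
  have hR : Module.Projective Rᵐᵒᵖ R := Module.Projective.of_equiv e
  let ev : (X →ₗ[R] R) →ₗ[Rᵐᵒᵖ] (Fin n → R) :=
    { toFun := fun g k => g (f (Pi.single k 1)), map_add' := fun _ _ => rfl
      map_smul' := fun _ _ => rfl }
  let back : (Fin n → R) →ₗ[Rᵐᵒᵖ] (X →ₗ[R] R) :=
    { toFun := fun c => (∑ k, (LinearMap.toSpanSingleton R R (c k)) ∘ₗ LinearMap.proj k) ∘ₗ s
      map_add' := fun c c' => by
        ext x
        simp [mul_add, Finset.sum_add_distrib]
      map_smul' := fun r c => by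
        ext x
        simp [Finset.sum_mul, mul_assoc] }
  have hRn : Module.Projective Rᵐᵒᵖ (Fin n → R) :=
    Module.Projective.of_equiv' (DFinsupp.linearEquivFunOnFintype (R := Rᵐᵒᵖ) (M := fun _ : Fin n => R))
  refine Module.Projective.of_split ev back ?_
  ext g x
  change (∑ k, (LinearMap.toSpanSingleton R R (g (f (Pi.single k 1)))) ∘ₗ LinearMap.proj k) (s x)
    = g x
  have : g ∘ₗ f = ∑ k, (LinearMap.toSpanSingleton R R (g (f (Pi.single k 1)))) ∘ₗ
      LinearMap.proj k := by
    refine LinearMap.pi_ext' fun k => LinearMap.ext_ring ?_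
    simp [Pi.single_apply]
  rw [← this]
  exact congrArg g (LinearMap.congr_fun hs x)

theorem isSES_dual {X Y Z : ModuleCat.{u} R} {i : X ⟶ Y} {p : Y ⟶ Z} (hex : Function.Exact i p)
    (hp : Function.Surjective p) (hi : Function.Surjective (dualMap i)) :
    IsSES (ModuleCat.ofHom (dualMap p)) (ModuleCat.ofHom (dualMap i)) := by
  refine ⟨fun a b hab => ?_, fun g => ⟨fun hg => ?_, ?_⟩, hi⟩
  · refine LinearMap.ext fun z => ?_
    obtain ⟨y, rfl⟩ := hp z
    exact LinearMap.congr_fun (show a ∘ₗ p.hom = b ∘ₗ p.hom from hab) y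
  · obtain ⟨g', hg'⟩ := exists_desc (W := ModuleCat.of R R) hex hp (ModuleCat.ofHom g)
      (ModuleCat.hom_ext hg)
    exact ⟨g'.hom, congrArg ModuleCat.Hom.hom hg'⟩
  · rintro ⟨g, rfl⟩
    change (g ∘ₗ p.hom) ∘ₗ i.hom = 0
    rw [LinearMap.comp_assoc, show p.hom ∘ₗ i.hom = 0 from
      congrArg ModuleCat.Hom.hom (comp_eq_zero_of_exact hex), LinearMap.comp_zero]

theorem isSES_range {X Y : ModuleCat.{u} R} (f : X ⟶ Y) :
    IsSES (ModuleCat.ofHom (LinearMap.range f.hom).subtype)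
      (ModuleCat.ofHom (LinearMap.range f.hom).mkQ) :=
  ⟨Subtype.val_injective, fun y => by
    change Submodule.Quotient.mk y = _ ↔ _
    rw [Submodule.Quotient.mk_eq_zero]
    exact ⟨fun hy => ⟨⟨y, hy⟩, rfl⟩, by rintro ⟨y, rfl⟩; exact y.2⟩, Submodule.mkQ_surjective _⟩

theorem hasProjectiveDimensionLT_dual (X : ModuleCat.{u} R) (hX : Module.Finite R X)
    (hX' : Module.Projective R X) (n : ℕ) :
    HasProjectiveDimensionLT (ModuleCat.of Rᵐᵒᵖ (X →ₗ[R] R)) (n + 1) := by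
  have : Module.Projective Rᵐᵒᵖ (ModuleCat.of Rᵐᵒᵖ (X →ₗ[R] R)) := projective_dual X hX hX'
  exact hasProjectiveDimensionLT_of_ge _ 1 _ (by omega)

/-- Dualizing `0 ⟶ M' ⟶ P ⟶ M ⟶ 0` keeps it exact when `Ext¹(M, R) = 0`, so each syzygy raises the
projective dimension of the dual by at most one. -/
theorem IsSyzygy.hasProjectiveDimensionLT_dual {k : ℕ} {X Y : ModuleCat.{u} R}
    (h : IsSyzygy k X Y) (hX : ∀ m < k, Subsingleton (Ext.{u} X (ModuleCat.of R R) (m + 1)))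
    (n : ℕ) (hn : HasProjectiveDimensionLT (ModuleCat.of Rᵐᵒᵖ (X →ₗ[R] R)) n) :
    HasProjectiveDimensionLT (ModuleCat.of Rᵐᵒᵖ (Y →ₗ[R] R)) (n + k) := by
  induction h generalizing n with
  | zero M N e =>
    refine hasProjectiveDimensionLT_of_iso (LinearEquiv.toModuleIso (LinearEquiv.ofBijective
      (dualMap e.inv) ⟨fun a b hab => ?_, fun g => ⟨g ∘ₗ e.hom.hom, ?_⟩⟩)) n
    · refine LinearMap.ext fun z => ?_
      obtain ⟨y, rfl⟩ := e.symm.toLinearEquiv.surjective z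
      exact LinearMap.congr_fun (show a ∘ₗ e.inv.hom = b ∘ₗ e.inv.hom from hab) y
    · refine LinearMap.ext fun z => ?_
      exact congrArg g (e.symm.toLinearEquiv.symm_apply_apply z)
  | succ k M M' P N i p hP hP' hi hex hp _ ih =>
    have hs : IsSES i p := ⟨hi, hex, hp⟩
    have hd := isSES_dual hex hp fun g => by
      obtain ⟨g', hg'⟩ := hs.exists_extension (hX 0 (by omega)) (ModuleCat.ofHom g)
      exact ⟨g'.hom, congrArg ModuleCat.Hom.hom hg'⟩
    have := ih (fun m hm => hs.ext_left (m + 1) (ext_of_projective hP' _ m)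
      (hX (m + 1) (by omega))) (n + 1)
      (hd.shortExact.hasProjectiveDimensionLT_X₃ n hn
        (GorTranspose.hasProjectiveDimensionLT_dual P hP hP' n))
    rwa [add_assoc, add_comm 1] at this

theorem IsProjPresentation.hasProjectiveDimensionLT_dualCoker {P₁ P₀ M : ModuleCat.{u} R}
    {f : P₁ ⟶ P₀} {p : P₀ ⟶ M} (h : IsProjPresentation f p) (n : ℕ)
    (hn : HasProjectiveDimensionLT (ModuleCat.of Rᵐᵒᵖ (M →ₗ[R] R)) n) :
    HasProjectiveDimensionLT (dualCoker f) (n + 2) := by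
  have h₁ : IsSES (ModuleCat.ofHom (dualMap p))
      (ModuleCat.ofHom (Y := LinearMap.range (dualMap f)) (dualMap f).rangeRestrict) := by
    refine ⟨fun a b hab => ?_, fun g => ⟨fun hg => ?_, ?_⟩, (dualMap f).surjective_rangeRestrict⟩
    · refine LinearMap.ext fun z => ?_
      obtain ⟨y, rfl⟩ := h.surjective z
      exact LinearMap.congr_fun (show a ∘ₗ p.hom = b ∘ₗ p.hom from hab) y
    · obtain ⟨g', hg'⟩ := exists_desc (W := ModuleCat.of R R) h.exact h.surjective
        (ModuleCat.ofHom g) (ModuleCat.hom_ext (congrArg Subtype.val hg))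
      exact ⟨g'.hom, congrArg ModuleCat.Hom.hom hg'⟩
    · rintro ⟨g, rfl⟩
      apply Subtype.ext
      change (g ∘ₗ p.hom) ∘ₗ f.hom = 0
      rw [LinearMap.comp_assoc, show p.hom ∘ₗ f.hom = 0 from
        congrArg ModuleCat.Hom.hom (comp_eq_zero_of_exact h.exact), LinearMap.comp_zero]
  have h₂ := isSES_range (ModuleCat.ofHom (dualMap f))
  exact h₂.shortExact.hasProjectiveDimensionLT_X₃ (n + 1)
    (h₁.shortExact.hasProjectiveDimensionLT_X₃ n hn
      (hasProjectiveDimensionLT_dual P₀ h.finite₀ h.projective₀ n))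
    (hasProjectiveDimensionLT_dual P₁ h.finite₁ h.projective₁ (n + 1))

end Syzygies

/-! ### Contravariant additive functors on finitely generated projective modules -/

section Tensor

open Opposite

theorem exists_dual_basis {A : Type u} [Ring A] (P : ModuleCat.{u} A) (hP : Module.Finite A P)
    (hP' : Module.Projective A P) :
    ∃ (n : ℕ) (x : Fin n → P) (g : Fin n → (P →ₗ[A] A)), ∀ y, ∑ i, g i y • x i = y := by
  obtain ⟨n, π, hπ⟩ := Module.Finite.exists_fin' A P
  obtain ⟨s, hs⟩ := Module.projective_lifting_property π LinearMap.id hπ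
  refine ⟨n, fun i => π (Pi.single i 1), fun i => LinearMap.proj i ∘ₗ s, fun y => ?_⟩
  have h1 := LinearMap.congr_fun hs y
  change π (s y) = y at h1
  have h2 : s y = ∑ i, s y i • Pi.single i (1 : A) := by
    ext j
    simp [Pi.single_apply]
  conv_rhs => rw [← h1, h2, map_sum]
  exact Finset.sum_congr rfl fun i _ => (map_smul π _ _).symm

variable {A R : Type u} [Ring A] [Ring R]

/-- The class of `w ⊗ x` in the tensor product `X ⊗_A Y`. -/
def tensorMk (X : Type u) [AddCommGroup X] [Module Aᵐᵒᵖ X]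
    (Y : Type u) [AddCommGroup Y] [Module A Y] [Module Rᵐᵒᵖ Y] [SMulCommClass A Rᵐᵒᵖ Y]
    (x : X) : Y →ₗ[Rᵐᵒᵖ] tensor A R X Y :=
  (Submodule.mkQ _) ∘ₗ (TensorProduct.AlgebraTensorModule.mk ℤ Rᵐᵒᵖ Y X).flip x

section

variable {X : Type u} [AddCommGroup X] [Module Aᵐᵒᵖ X]
    {Y : Type u} [AddCommGroup Y] [Module A Y] [Module Rᵐᵒᵖ Y] [SMulCommClass A Rᵐᵒᵖ Y]

theorem tensorMk_add (x x' : X) (y : Y) :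
    tensorMk (A := A) (R := R) X Y (x + x') y = tensorMk X Y x y + tensorMk X Y x' y :=
  congrArg Submodule.Quotient.mk (TensorProduct.tmul_add y x x')

theorem tensorMk_zero (y : Y) : tensorMk (A := A) (R := R) X Y 0 y = 0 :=
  congrArg Submodule.Quotient.mk (TensorProduct.tmul_zero X y)

theorem tensorMk_sum {ι : Type*} (s : Finset ι) (x : ι → X) (y : Y) :
    tensorMk (A := A) (R := R) X Y (∑ i ∈ s, x i) y = ∑ i ∈ s, tensorMk X Y (x i) y := by
  classical
  induction s using Finset.induction_on with
  | empty => exact tensorMk_zero y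
  | insert a s ha ih => rw [Finset.sum_insert ha, Finset.sum_insert ha, tensorMk_add, ih]

theorem tensorMk_smul (a : A) (x : X) (y : Y) :
    tensorMk (A := A) (R := R) X Y x (a • y) = tensorMk X Y (MulOpposite.op a • x) y := by
  refine Eq.symm ((Submodule.Quotient.eq _).2 (Submodule.subset_span ⟨x, a, y, rfl⟩))

theorem tensor_induction {p : tensor A R X Y → Prop}
    (mk : ∀ x y, p (tensorMk X Y x y)) (add : ∀ t t', p t → p t' → p (t + t'))
    (t : tensor A R X Y) : p t := by
  obtain ⟨t, rfl⟩ := Submodule.mkQ_surjective _ t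
  induction t using TensorProduct.induction_on with
  | zero =>
    have h := mk 0 0
    rwa [show tensorMk X Y 0 0 = Submodule.mkQ _ (0 : Y ⊗[ℤ] X) from
      congrArg Submodule.Quotient.mk (TensorProduct.tmul_zero X 0)] at h
  | tmul y x => exact mk x y
  | add t t' h h' => rw [map_add]; exact add _ _ h h'

/-- A biadditive map that is balanced over `A` and linear over `Rᵐᵒᵖ` in `Y` induces a map on the
tensor product. -/
def tensorLift {Z : Type u} [AddCommGroup Z] [Module Rᵐᵒᵖ Z] (b : X →+ (Y →ₗ[Rᵐᵒᵖ] Z))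
    (hb : ∀ x (a : A) y, b (MulOpposite.op a • x) y = b x (a • y)) :
    tensor A R X Y →ₗ[Rᵐᵒᵖ] Z :=
  Submodule.liftQ _ (TensorProduct.AlgebraTensorModule.lift
    b.toIntLinearMap.flip) (by
    rw [Submodule.span_le]
    rintro _ ⟨x, a, y, rfl⟩
    change TensorProduct.AlgebraTensorModule.lift b.toIntLinearMap.flip _ = 0
    rw [map_sub, sub_eq_zero]
    exact hb x a y)

end

theorem map_sum_op (F : (ModuleCat.{u} A)ᵒᵖ ⥤ ModuleCat.{u} Rᵐᵒᵖ) [F.Additive]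
    {X Y : ModuleCat.{u} A} {ι : Type*} (s : Finset ι) (f : ι → (X ⟶ Y)) (z : F.obj (op Y)) :
    (F.map (∑ i ∈ s, f i).op).hom z = ∑ i ∈ s, (F.map (f i).op).hom z := by
  classical
  induction s using Finset.induction_on with
  | empty =>
    rw [Finset.sum_empty, Finset.sum_empty, show (0 : X ⟶ Y).op = 0 from rfl, F.map_zero]
    rfl
  | insert a s ha ih =>
    rw [Finset.sum_insert ha, Finset.sum_insert ha, op_add, F.map_add, ← ih]
    rfl

/-- The map `A ⟶ P` sending `1` to `x`. -/
abbrev point {P : ModuleCat.{u} A} (x : P) : ModuleCat.of A A ⟶ P :=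
  ModuleCat.ofHom (LinearMap.toSpanSingleton A P x)

/-- For a contravariant additive functor `F` and a map `f` of finitely generated projective
`A`-modules, `Coker F(f)` is `Coker Hom_A(f, A) ⊗_A F(A)`: both sides are right exact in `f`, and
they agree on finitely generated projective modules. The inverse of the natural map
`Hom_A(P, A) ⊗_A F(A) ⟶ F(P)` is written down with a dual basis of `P`. -/
theorem nonempty_tensor_dualCoker_equiv (F : (ModuleCat.{u} A)ᵒᵖ ⥤ ModuleCat.{u} Rᵐᵒᵖ)
    [F.Additive] (E : Type u) [AddCommGroup E] [Module A E] [Module Rᵐᵒᵖ E] [SMulCommClass A Rᵐᵒᵖ E]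
    (e : E ≃ₗ[Rᵐᵒᵖ] F.obj (op (ModuleCat.of A A)))
    (he : ∀ (a : A) (w : E), e (a • w) = (F.map (point (P := ModuleCat.of A A) a).op).hom (e w))
    {P₁ P₀ : ModuleCat.{u} A} (f : P₁ ⟶ P₀)
    (h₁ : Module.Finite A P₁) (h₁' : Module.Projective A P₁)
    (h₀ : Module.Finite A P₀) (h₀' : Module.Projective A P₀) :
    Nonempty (tensor A R (dualCoker f) E ≃ₗ[Rᵐᵒᵖ]
      (F.obj (op P₁) ⧸ LinearMap.range (F.map f.op).hom)) := by
  obtain ⟨n, x, g, hxg⟩ := exists_dual_basis P₁ h₁ h₁'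
  obtain ⟨m, y, h, hyh⟩ := exists_dual_basis P₀ h₀ h₀'
  have hF : ∀ {X Y Z : ModuleCat.{u} A} (a : X ⟶ Y) (b : Y ⟶ Z) (z : F.obj (op Z)),
      (F.map a.op).hom ((F.map b.op).hom z) = (F.map (a ≫ b).op).hom z := fun a b z => by
    rw [op_comp, F.map_comp]; rfl
  -- `θ k w = k^* w`, as a biadditive map.
  let θ₀ : (P₁ →ₗ[A] A) →+ (E →ₗ[Rᵐᵒᵖ] F.obj (op P₁)) := AddMonoidHom.mk'
    (fun k => (F.map (ModuleCat.ofHom (Y := A) k).op).hom ∘ₗ e.toLinearMap) (fun k k' => by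
      rw [show ModuleCat.ofHom (Y := A) (k + k') = ModuleCat.ofHom k + ModuleCat.ofHom k' from rfl,
        op_add, F.map_add]
      rfl)
  have hθ₀ : ∀ (k : P₁ →ₗ[A] A) (a : A) (w : E), θ₀ (MulOpposite.op a • k) w = θ₀ k (a • w) := by
    intro k a w
    change (F.map _).hom (e w) = (F.map _).hom (e (a • w))
    rw [he, hF]
    rfl
  let θ₁ : dualCoker f →+ (E →ₗ[Rᵐᵒᵖ] F.obj (op P₁) ⧸ LinearMap.range (F.map f.op).hom) :=
    QuotientAddGroup.lift (LinearMap.range (dualMap f)).toAddSubgroup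
      (AddMonoidHom.mk' (fun k => (LinearMap.range (F.map f.op).hom).mkQ ∘ₗ θ₀ k) (fun k k' => by
        rw [map_add, LinearMap.comp_add])) (by
      rintro _ ⟨k, rfl⟩
      refine LinearMap.ext fun w => ?_
      refine (Submodule.Quotient.mk_eq_zero _).2
        ⟨(F.map (ModuleCat.ofHom (Y := A) k).op).hom (e w), ?_⟩
      rw [hF]
      rfl)
  let Θ : tensor A R (dualCoker f) E →ₗ[Rᵐᵒᵖ] F.obj (op P₁) ⧸ LinearMap.range (F.map f.op).hom :=
    tensorLift θ₁ (fun k a w => by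
      obtain ⟨k, rfl⟩ := Submodule.mkQ_surjective _ k
      exact congrArg Submodule.Quotient.mk (hθ₀ k a w))
  let cl : (P₁ →ₗ[A] A) → dualCoker f := fun k => Submodule.Quotient.mk k
  have hΘ : ∀ k w, Θ (tensorMk (A := A) (R := R) _ E (cl k) w) = Submodule.Quotient.mk (θ₀ k w) := fun k w => rfl
  let Ψ₀ : F.obj (op P₁) →ₗ[Rᵐᵒᵖ] tensor A R (dualCoker f) E :=
    ∑ i, tensorMk (A := A) (R := R) _ E (cl (g i)) ∘ₗ e.symm.toLinearMap ∘ₗ (F.map (point (x i)).op).hom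
  have hΨ₀ : ∀ z, Ψ₀ z =
      ∑ i, tensorMk (A := A) (R := R) _ E (cl (g i)) (e.symm ((F.map (point (x i)).op).hom z)) := fun z => by
    simp only [Ψ₀, LinearMap.sum_apply]
    rfl
  -- An element `k` of the dual of `P₁` is the sum of the `k (x i)` times the `g i`.
  have hdual : ∀ k : P₁ →ₗ[A] A, ∑ i, MulOpposite.op (k (x i)) • g i = k := by
    intro k
    ext z
    conv_rhs => rw [← hxg z, map_sum]
    rw [LinearMap.sum_apply]
    exact Finset.sum_congr rfl fun i _ => (map_smul k _ _).symm
  have hcl : ∀ (k : P₁ →ₗ[A] A), ∑ i, MulOpposite.op (k (x i)) • cl (g i) = cl k := by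
    intro k
    conv_rhs => rw [← hdual k]
    exact (map_sum (LinearMap.range (dualMap f)).mkQ _ _).symm
  have hmove : ∀ (k : P₁ →ₗ[A] A) (w : E),
      ∑ i, tensorMk (A := A) (R := R) _ E (cl (g i)) (k (x i) • w) = tensorMk (A := A) (R := R) _ E (cl k) w := by
    intro k w
    simp_rw [tensorMk_smul]
    rw [← tensorMk_sum, hcl]
  have hΨθ : ∀ k w, Ψ₀ (θ₀ k w) = tensorMk (A := A) (R := R) _ E (cl k) w := by
    intro k w
    rw [hΨ₀, ← hmove k w]
    refine Finset.sum_congr rfl fun i _ => ?_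
    congr 1
    rw [LinearEquiv.symm_apply_eq, he]
    change (F.map _).hom ((F.map _).hom (e w)) = _
    rw [hF]
    congr 4
    ext
    simp
  have hθΨ : ∀ z, Θ (Ψ₀ z) = Submodule.Quotient.mk z := by
    intro z
    rw [hΨ₀, map_sum]
    have : z = ∑ i, θ₀ (g i) (e.symm ((F.map (point (x i)).op).hom z)) := by
      have h1 : (𝟙 P₁) = ∑ i, ModuleCat.ofHom (Y := A) (g i) ≫ point (x i) := by
        refine ModuleCat.hom_ext (LinearMap.ext fun w => ?_)
        rw [ModuleCat.hom_sum, LinearMap.sum_apply]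
        exact (hxg w).symm
      conv_lhs => rw [show z = (F.map (𝟙 P₁).op).hom z by simp, h1, map_sum_op]
      refine Finset.sum_congr rfl fun i _ => ?_
      change _ = (F.map _).hom (e (e.symm _))
      rw [e.apply_symm_apply, hF]
    conv_rhs => rw [this]
    exact (map_sum (LinearMap.range (F.map f.op).hom).mkQ _ _).symm
  -- Expanding `f (x i)` in a dual basis of `P₀` shows that `Ψ₀` kills the image of `F(P₀)`.
  have hkill : LinearMap.range (F.map f.op).hom ≤ LinearMap.ker Ψ₀ := by
    rintro _ ⟨z, rfl⟩
    change Ψ₀ _ = 0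
    let w : Fin m → E := fun j => e.symm ((F.map (point (y j)).op).hom z)
    have h1 : ∀ i, e.symm ((F.map (point (x i)).op).hom ((F.map f.op).hom z)) =
        ∑ j, (dualMap f (h j)) (x i) • w j := by
      intro i
      rw [LinearEquiv.symm_apply_eq, map_sum, hF]
      have h2 : point (x i) ≫ f =
          ∑ j, point (P := ModuleCat.of A A) ((dualMap f (h j)) (x i)) ≫ point (y j) := by
        refine ModuleCat.hom_ext (LinearMap.ext fun a => ?_)
        rw [ModuleCat.hom_sum, LinearMap.sum_apply]
        change f.hom (a • x i) = ∑ j, (a • (h j) (f.hom (x i))) • y j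
        simp_rw [smul_assoc]
        rw [← Finset.smul_sum, hyh, map_smul]
      rw [h2, map_sum_op]
      refine Finset.sum_congr rfl fun j _ => ?_
      rw [he, ← hF]
      change _ = (F.map _).hom (e (e.symm _))
      rw [e.apply_symm_apply]
    rw [hΨ₀]
    simp_rw [h1, map_sum]
    rw [Finset.sum_comm]
    refine Finset.sum_eq_zero fun j _ => ?_
    rw [hmove, show cl (dualMap f (h j)) = 0 from
      (Submodule.Quotient.mk_eq_zero _).2 ⟨h j, rfl⟩, tensorMk_zero]
  let Ψ : (F.obj (op P₁) ⧸ LinearMap.range (F.map f.op).hom) →ₗ[Rᵐᵒᵖ]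
    tensor A R (dualCoker f) E := (LinearMap.range (F.map f.op).hom).liftQ Ψ₀ hkill
  refine ⟨LinearEquiv.ofLinearMap Θ Ψ (LinearMap.ext fun z => ?_) (LinearMap.ext fun t => ?_)⟩
  · obtain ⟨z, rfl⟩ := Submodule.mkQ_surjective _ z
    exact hθΨ z
  · change Ψ (Θ t) = t
    induction t using tensor_induction with
    | mk k w =>
      obtain ⟨k, rfl⟩ := Submodule.mkQ_surjective _ k
      exact hΨθ k w
    | add t t' h h' => rw [map_add, map_add, h, h']

end Tensor

/-! ### Modules over a finite extension of rings -/

section Restriction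

open Opposite Abelian Abelian.Ext

variable {R A : Type u} [Ring R] [Ring A] (φ : R →+* A)

/-- The restriction of scalars of an `A`-module along `φ`. -/
abbrev res (X : ModuleCat.{u} A) : ModuleCat.{u} R := (ModuleCat.restrictScalars φ).obj X

/-- The restriction of scalars of an `A`-linear map along `φ`. -/
abbrev resMap {X Y : ModuleCat.{u} A} (f : X ⟶ Y) : res φ X ⟶ res φ Y :=
  (ModuleCat.restrictScalars φ).map f

theorem IsSES.res {X Y Z : ModuleCat.{u} A} {i : X ⟶ Y} {p : Y ⟶ Z} (h : IsSES i p) :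
    IsSES (resMap φ i) (resMap φ p) := ⟨h.injective, h.exact, h.surjective⟩

/-- The functor `Hom_R(-, R)` on `A`-modules. -/
def homFunctor : (ModuleCat.{u} A)ᵒᵖ ⥤ ModuleCat.{u} Rᵐᵒᵖ where
  obj X := ModuleCat.of Rᵐᵒᵖ (res φ X.unop →ₗ[R] R)
  map f := ModuleCat.ofHom (dualMap (resMap φ f.unop))

instance : (homFunctor φ).Additive where
  map_add {X _ f g} := ModuleCat.hom_ext (LinearMap.ext fun (h : res φ X.unop →ₗ[R] R) =>
    LinearMap.ext fun x => map_add h (f.unop.hom x) (g.unop.hom x))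

/-- The functor `Ext^n_R(-, R)` on `A`-modules. -/
def extFunctor (n : ℕ) : (ModuleCat.{u} A)ᵒᵖ ⥤ ModuleCat.{u} Rᵐᵒᵖ where
  obj X := ModuleCat.of Rᵐᵒᵖ (Ext.{u} (res φ X.unop) (ModuleCat.of R R) n)
  map f := ModuleCat.ofHom (extMap (resMap φ f.unop) n)
  map_id X := ModuleCat.hom_ext (extMap_id (res φ X.unop) n)
  map_comp f g := ModuleCat.hom_ext (LinearMap.ext fun e =>
    extMap_comp (resMap φ g.unop) (resMap φ f.unop) n e)

instance (n : ℕ) : (extFunctor φ n).Additive where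
  map_add {_ _ f g} := ModuleCat.hom_ext (extMap_add (resMap φ f.unop) (resMap φ g.unop) n)

theorem nonempty_tensorHom_equiv {P₁ P₀ M : ModuleCat.{u} A} {f : P₁ ⟶ P₀} {p : P₀ ⟶ M}
    (h : IsProjPresentation f p) :
    Nonempty (tensorHom φ (dualCoker f) ≃ₗ[Rᵐᵒᵖ] dualCoker (resMap φ f)) :=
  nonempty_tensor_dualCoker_equiv (homFunctor φ) (HomAR φ) (LinearEquiv.refl Rᵐᵒᵖ (HomAR φ))
    (fun _ _ => rfl) f h.finite₁ h.projective₁ h.finite₀ h.projective₀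

theorem nonempty_tensorExt_equiv {P₁ P₀ M : ModuleCat.{u} A} {f : P₁ ⟶ P₀} {p : P₀ ⟶ M}
    (h : IsProjPresentation f p) (n : ℕ) :
    Nonempty (tensorExt φ (dualCoker f) n ≃ₗ[Rᵐᵒᵖ] extCoker (resMap φ f) n) :=
  nonempty_tensor_dualCoker_equiv (extFunctor φ n) (ExtAR φ n)
    (LinearEquiv.refl Rᵐᵒᵖ (ExtAR φ n)) (fun _ _ => rfl) f h.finite₁ h.projective₁ h.finite₀
    h.projective₀

/-- `P` is a direct summand of some `A^m`; a dual basis splits every Ext class on `P` accordingly. -/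
theorem ext_res_of_projective {P : ModuleCat.{u} A} (hP : Module.Finite A P)
    (hP' : Module.Projective A P) {Y : ModuleCat.{u} R} {n : ℕ}
    (h : Subsingleton (Ext.{u} (leftRestrict φ) Y n)) : Subsingleton (Ext.{u} (res φ P) Y n) := by
  obtain ⟨m, x, g, hxg⟩ := exists_dual_basis P hP hP'
  refine subsingleton_of_forall_eq 0 fun e => ?_
  have h1 : 𝟙 (res φ P) =
      ∑ i, resMap φ (ModuleCat.ofHom (Y := A) (g i)) ≫ resMap φ (point (x i)) := by
    refine ModuleCat.hom_ext (LinearMap.ext fun w => ?_)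
    rw [ModuleCat.hom_sum, LinearMap.sum_apply]
    exact (hxg w).symm
  rw [← mk₀_id_comp e, h1, mk₀_sum, sum_comp]
  refine Finset.sum_eq_zero fun i _ => ?_
  rw [← mk₀_comp_mk₀_assoc, h.elim ((mk₀ (resMap φ (point (x i)))).comp e (zero_add n)) 0, comp_zero]

theorem finite_res (hA : Module.Finite R (leftRestrict φ)) {X : ModuleCat.{u} A}
    (hX : Module.Finite A X) : Module.Finite R (res φ X) := by
  obtain ⟨n, f, hf⟩ := Module.Finite.exists_fin' A X
  let f' : (Fin n → leftRestrict φ) →ₗ[R] res φ X :=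
    { toFun := f, map_add' := map_add f, map_smul' := fun r v => map_smul f (φ r) v }
  exact Module.Finite.of_surjective f' hf

theorem finite_of_finite_res {X : ModuleCat.{u} A} (hX : Module.Finite R (res φ X)) :
    Module.Finite A X := by
  obtain ⟨S, hS⟩ := hX.fg_top
  let S' : Finset X := S
  let N : Submodule R (res φ X) :=
    { carrier := ((Submodule.span A (S' : Set X) : Submodule A X) : Set X)
      add_mem' := fun ha hb => add_mem (S := Submodule A X) ha hb
      zero_mem' := zero_mem (Submodule.span A (S' : Set X))
      smul_mem' := fun r _ hx => Submodule.smul_mem (Submodule.span A (S' : Set X)) (φ r) hx }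
  refine ⟨⟨S', top_le_iff.1 fun x _ => ?_⟩⟩
  have h1 : Submodule.span R (S : Set (res φ X)) ≤ N :=
    Submodule.span_le.2 (Submodule.subset_span (R := A) (s := (S' : Set X)))
  rw [hS] at h1
  exact h1 (x := x) Submodule.mem_top

variable {φ}

/-- If `Ext^i_R(A, R) = 0` for `i < n`, then `Ext^i_R(X, R) = 0` for `i < n` and every finitely
generated `A`-module `X`, by dimension shifting along free `A`-modules. -/
theorem ext_res_of_lt [IsNoetherianRing R] (hA : Module.Finite R (leftRestrict φ)) {n : ℕ}
    (h : ∀ i < n, Subsingleton (Ext.{u} (leftRestrict φ) (ModuleCat.of R R) i))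
    {X : ModuleCat.{u} A} (hX : Module.Finite A X) (i : ℕ) (hi : i < n) :
    Subsingleton (Ext.{u} (res φ X) (ModuleCat.of R R) i) := by
  induction i generalizing X with
  | zero =>
    obtain ⟨F, p, hF, hF', hp⟩ := exists_free_cover X hX
    have h0 := ext_res_of_projective φ hF hF' (h 0 hi)
    have : Epi (resMap φ p) := (ModuleCat.epi_iff_surjective _).2 hp
    exact (precomp_mk₀_injective_of_epi (ModuleCat.of R R) (resMap φ p)).subsingleton
  | succ i ih =>
    obtain ⟨F, p, hF, hF', hp⟩ := exists_free_cover X hX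
    have hs := isSES_ker p hp
    exact (hs.res φ).ext_right i (ih (finite_of_finite_res φ (finite_of_injective _
      (hs.res φ).injective (finite_res φ hA hF))) (by omega)) (ext_res_of_projective φ hF hF' (h _ hi))

theorem isFourTerm_res {P₁ P₀ M : ModuleCat.{u} A} {f : P₁ ⟶ P₀} {p : P₀ ⟶ M}
    (h : IsProjPresentation f p) :
    IsFourTerm (resMap φ (ModuleCat.ofHom (LinearMap.ker f.hom).subtype)) (resMap φ f)
      (resMap φ p) :=
  ⟨Subtype.val_injective, fun y => ⟨fun hy => ⟨(⟨y, hy⟩ : LinearMap.ker f.hom), rfl⟩, by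
    rintro ⟨y, rfl⟩; exact y.2⟩, h.exact, h.surjective⟩

/-- The kernel of `Ext^n_R(f, R)` comes from `M` when `Ext^i_R(A, R) = 0` for `i < n`. -/
theorem exists_extMap_of_extMap_eq_zero [IsNoetherianRing R]
    (hA : Module.Finite R (leftRestrict φ)) {n : ℕ} (hn : n ≠ 0)
    (h : ∀ i < n, Subsingleton (Ext.{u} (leftRestrict φ) (ModuleCat.of R R) i))
    {P₁ P₀ M : ModuleCat.{u} A} {f : P₁ ⟶ P₀} {p : P₀ ⟶ M} (hP : IsProjPresentation f p)
    (e : Ext.{u} (res φ P₀) (ModuleCat.of R R) n) (he : extMap (resMap φ f) n e = 0) :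
    ∃ e', e = extMap (resMap φ p) n e' := by
  obtain ⟨k, rfl⟩ := Nat.exists_eq_succ_of_ne_zero hn
  let B : ModuleCat.{u} A := ModuleCat.of A (LinearMap.range f.hom)
  let f₁ : P₁ ⟶ B := ModuleCat.ofHom f.hom.rangeRestrict
  let b : B ⟶ P₀ := ModuleCat.ofHom (LinearMap.range f.hom).subtype
  have h₁ := isSES_ker f₁ f.hom.surjective_rangeRestrict
  have h₂ : IsSES b p := ⟨Subtype.val_injective, fun y => by
    rw [hP.exact y]
    exact ⟨fun hy => ⟨⟨y, hy⟩, rfl⟩, by rintro ⟨y, rfl⟩; exact y.2⟩, hP.surjective⟩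
  have hL := ext_res_of_lt hA h (finite_of_finite_res φ (finite_of_injective _
    (h₁.res φ).injective (finite_res φ hA hP.finite₁))) k (Nat.lt_succ_self k)
  have hb : extMap (resMap φ b) (k + 1) e = 0 := by
    obtain ⟨e₁, he₁⟩ := contravariant_sequence_exact₃ (h₁.res φ).shortExact _
      (extMap (resMap φ b) (k + 1) e) ((extMap_comp _ _ _ e).symm.trans he) (add_comm 1 k)
    rw [← he₁, hL.elim e₁ 0, comp_zero]
  obtain ⟨e', rfl⟩ := contravariant_sequence_exact₂ (h₂.res φ).shortExact _ e hb
  exact ⟨e', rfl⟩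

theorem subsingleton_dual_of_ext_zero {X : ModuleCat.{u} R}
    (h : Subsingleton (Ext.{u} X (ModuleCat.of R R) 0)) : Subsingleton (X →ₗ[R] R) := by
  refine ⟨fun g g' => ?_⟩
  have := (mk₀_bijective X (ModuleCat.of R R)).1
    (h.elim (mk₀ (ModuleCat.ofHom g)) (mk₀ (ModuleCat.ofHom g')))
  exact congrArg ModuleCat.Hom.hom this

theorem ExistsShortExact.of_iso_left {S : Type u} [Ring S] {X X' Y Z : ModuleCat.{u} S}
    (h : ExistsShortExact X Y Z) (e : X' ≅ X) : ExistsShortExact X' Y Z := by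
  obtain ⟨i, q, hi, hex, hq⟩ := h
  refine ⟨e.hom ≫ i, q, hi.comp e.toLinearEquiv.injective, fun y => ?_, hq⟩
  rw [hex y]
  constructor
  · rintro ⟨x, rfl⟩
    exact ⟨e.inv x, congrArg i (e.toLinearEquiv.apply_symm_apply x)⟩
  · rintro ⟨x, rfl⟩
    exact ⟨_, rfl⟩

end Restriction

end GorTranspose

end

theorem theorem3p6 {R A : Type u} [Ring R] [Ring A]
    [IsNoetherianRing R] [IsNoetherianRing Rᵐᵒᵖ]
    (φ : R →+* A) (hφ : GorTranspose.IsFiniteHom φ)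
    (hG : ∃ m : ℕ, GorTranspose.GpdLE m (GorTranspose.leftRestrict φ))
    (n : ℕ)
    (hExt : ∀ i : ℕ, i ≠ n →
      Subsingleton (Abelian.Ext.{u} (GorTranspose.leftRestrict φ) (ModuleCat.of R R) i))
    (M : ModuleCat.{u} A) [Module.Finite A M]
    -- a presentation of `M` over `A`; it yields `Tr_A(M) = dualCoker f` and `Ω²_A(M) = ker f`
    {P₁ P₀ : ModuleCat.{u} A} (f : P₁ ⟶ P₀) (p : P₀ ⟶ M)
    (hP : GorTranspose.IsProjPresentation f p) :
    (n = 0 →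
      ∃ T : ModuleCat.{u} Rᵐᵒᵖ,
        GorTranspose.IsGorensteinTranspose ((ModuleCat.restrictScalars φ).obj M) T ∧
        Nonempty (T ≅ GorTranspose.tensorHom φ (GorTranspose.dualCoker f))) ∧
    (n = 1 → (∀ r s : R, r * s = s * r) →
      ∀ N : ModuleCat.{u} R,
        GorTranspose.IsSyzygy 1 ((ModuleCat.restrictScalars φ).obj M) N →
        ∃ Q T : ModuleCat.{u} Rᵐᵒᵖ,
          Module.Finite Rᵐᵒᵖ Q ∧ Module.Projective Rᵐᵒᵖ Q ∧
          GorTranspose.IsGorensteinTranspose N T ∧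
          GorTranspose.ExistsShortExact Q T
            (GorTranspose.tensorExt φ (GorTranspose.dualCoker f) 1)) ∧
    (2 ≤ n → (∀ r s : R, r * s = s * r) →
      ∀ (N L : ModuleCat.{u} R) (K : ModuleCat.{u} Rᵐᵒᵖ),
        GorTranspose.IsSyzygy n ((ModuleCat.restrictScalars φ).obj M) N →
        GorTranspose.IsSyzygy (n - 2)
          ((ModuleCat.restrictScalars φ).obj (ModuleCat.of A (LinearMap.ker f.hom))) L →
        GorTranspose.IsTranspose L K →
        HasProjectiveDimensionLE K (n - 1) ∧
        ∃ T : ModuleCat.{u} Rᵐᵒᵖ,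
          GorTranspose.IsGorensteinTranspose N T ∧
          GorTranspose.ExistsShortExact K T
            (GorTranspose.tensorExt φ (GorTranspose.dualCoker f) n)) := by
  open GorTranspose in
  have hA := hφ.1
  obtain ⟨d, hd⟩ := hG
  have hv := hd.vanishAbove
  have hlt : ∀ i < n, Subsingleton (Abelian.Ext.{u} (leftRestrict φ) (ModuleCat.of R R) i) :=
    fun i hi => hExt i hi.ne
  have hgt : ∀ {P : ModuleCat.{u} A}, Module.Finite A P → Module.Projective A P → ∀ m, n < m →
      Subsingleton (Abelian.Ext.{u} (res φ P) (ModuleCat.of R R) m) := fun h h' m hm =>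
    ext_res_of_projective φ h h' (hExt m hm.ne')
  have hvP : ∀ {P : ModuleCat.{u} A}, Module.Finite A P → Module.Projective A P →
      VanishAbove d (res φ P) := fun h h' Z hZ j hj =>
    ext_res_of_projective φ h h' (hv Z hZ j hj)
  have hfin₁ := finite_res φ hA hP.finite₁
  have hfour : IsFourTerm _ (resMap φ f) (resMap φ p) := isFourTerm_res hP
  refine ⟨?_, ?_, ?_⟩
  · rintro rfl
    obtain ⟨e⟩ := nonempty_tensorHom_equiv φ hP
    refine ⟨dualCoker (resMap φ f), ⟨_, _, resMap φ f, resMap φ p, ⟨hfin₁, ?_,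
      finite_res φ hA hP.finite₀, ?_, hP.exact, hP.surjective⟩, ⟨Iso.refl _⟩⟩,
      ⟨e.symm.toModuleIso⟩⟩
    · exact HasGorensteinVanishing.isGorensteinProjective
        ⟨hfin₁, fun j => hgt hP.finite₁ hP.projective₁ _ j.succ_pos, d,
          hvP hP.finite₁ hP.projective₁⟩
    · exact HasGorensteinVanishing.isGorensteinProjective
        ⟨finite_res φ hA hP.finite₀, fun j => hgt hP.finite₀ hP.projective₀ _ j.succ_pos, d,
          hvP hP.finite₀ hP.projective₀⟩
  · rintro rfl - N hN
    obtain ⟨e⟩ := nonempty_tensorExt_equiv φ hP 1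
    obtain ⟨Q, T, hQ, hQ', hT, hs⟩ := hfour.exists_gorensteinTranspose_of_one hfin₁
      (hgt hP.finite₁ hP.projective₁) (hvP hP.finite₁ hP.projective₁)
      (hgt hP.finite₀ hP.projective₀) (hvP hP.finite₀ hP.projective₀)
      (exists_extMap_of_extMap_eq_zero hA one_ne_zero hlt hP)
      (subsingleton_dual_of_ext_zero (ext_res_of_lt hA hlt hP.finite₁ 0 one_pos)) hN
    exact ⟨_, T, finite_dual Q hQ, projective_dual Q hQ hQ', hT, hs.of_equiv e.symm⟩
  · intro hn _ N L K hN hL hK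
    obtain ⟨k, rfl⟩ := Nat.exists_eq_add_of_le' hn
    rw [Nat.add_sub_cancel] at hL
    obtain ⟨Q₁, Q₀, g, t, hg, ⟨eK⟩⟩ := hK
    obtain ⟨e⟩ := nonempty_tensorExt_equiv φ hP (k + 2)
    have hker : Module.Finite A (ModuleCat.of A (LinearMap.ker f.hom)) :=
      finite_of_finite_res φ (finite_of_injective _ hfour.injective hfin₁)
    have hextL := ext_res_of_lt hA hlt hker
    constructor
    · have h0 : HasProjectiveDimensionLT (ModuleCat.of Rᵐᵒᵖ
          (res φ (ModuleCat.of A (LinearMap.ker f.hom)) →ₗ[R] R)) 0 := by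
        have := subsingleton_dual_of_ext_zero (hextL 0 (by omega))
        exact (ModuleCat.isZero_of_subsingleton _).hasProjectiveDimensionLT_zero
      have h1 := hL.hasProjectiveDimensionLT_dual (fun m hm => hextL (m + 1) (by omega)) 0 h0
      rw [zero_add] at h1
      have h2 := hg.hasProjectiveDimensionLT_dualCoker k h1
      exact hasProjectiveDimensionLT_of_iso eK.symm (k + 2)
    · obtain ⟨T, hT, hs⟩ := hfour.exists_gorensteinTranspose k hfin₁
        (hgt hP.finite₁ hP.projective₁) (hvP hP.finite₁ hP.projective₁)
        (hgt hP.finite₀ hP.projective₀) (hvP hP.finite₀ hP.projective₀)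
        (exists_extMap_of_extMap_eq_zero hA (Nat.succ_ne_zero _) hlt hP)
        (hextL (k + 1) (by omega)) hN hL hg
      exact ⟨T, hT, (hs.of_equiv e.symm).of_iso_left eK⟩
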